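/- **Setting.** Let $n\ge 1$ be a constant, $\ell=\ell(\lambda)$ a polynomially bounded bit width, $R=\mathbb Z_{2^\ell}$, and $f=f(\lambda)$ a number of fractional bits. A ring element $z$ has a signed (two's complement) value $\tilde z\in[-2^{\ell-1},2^{\ell-1})$ and represents the real number $\tilde z/2^f$; a real $v$ is encoded as $\lfloor v2^f\rfloor \bmod 2^\ell$. Secrets are additively shared: $x=\langle x\rangle_0+\langle x\rangle_1$ in $R$, and $\mathrm{Share}(\alpha)=(\alpha-r,r)$ with $r$ uniform. Sums and products with public constants are computed locally (public constants are added by $P_1$), and opening means exchanging shares. "PPT" means strict probabilistic polynomial time with input $1^\lambda,1^\ell$; $\approx_c$ means that every non-uniform PPT distinguisher has a negligible advantage, uniformly over all inputs. **Distributed comparison function (DCF).** PPT algorithms $(K_0,K_1)\leftarrow \mathrm{Gen}(1^\lambda,\alpha)$ and (deterministic) $\mathrm{Eval}(b,K_b,m)$ with: - Correctness: with probability $1$, for all $m\in R$, $\mathrm{Eval}(0,K_0,m)+\mathrm{Eval}(1,K_1,m)$ is $1$ if the signed value of $m-\alpha$ is negative and $0$ otherwise. - Security: for each $b$ there is a PPT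 $\mathrm{Sim}_b$ with $K_b\approx_c \mathrm{Sim}_b(1^\lambda,1^\ell)$, for all $\alpha$. **Approximated functions.** Let $\omega_i=-5+10i/n$ for $0\le i\le n$, let $\bar\omega_i$ be $\omega_i$ rounded down to $f$ fractional bits, and $\delta(t)=1/(1+e^{-t})$. For real $t$ let $I(t)$ be the largest $i\le n$ with $\bar\omega_i\le t$, and $I(t)=0$ if $t<\bar\omega_0$. Then $\delta'(t)=\delta(\omega_{I(t)})$ and $w'(G,H)=\omega_{I(-G/H)}$. **Protocols.** Write $\hat\omega_i=\lfloor\omega_i2^f\rfloor$. Let $T_i$ be the encoding of $\delta(\omega_i)$ in $\Pi_{\mathrm{LUT}_\delta^n}$ (input $\langle x\rangle$) and of $\omega_i$ in $\Pi_{\mathrm{LUT}_w^n}$ (inputs $\langle G\rangle,\langle H\rangle$). - Offline: for $0\le i\le n$ a trusted dealer draws independent uniform $\alpha_i\in R$, computes $(K_0^i,K_1^i)\leftarrow\mathrm{Gen}(1^\lambda,\alpha_i)$, and gives $\langle\alpha_i\rangle_b$ and $K^i_b$ to $P_b$. - Online: for $1\le i\le n$ the parties open $m_i=d_i+\alpha_i$,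 where $d_i=x-\hat\omega_i$ for the sigmoid and $d_i=-2^fG-\hat\omega_iH$ for the leaf weight. They set $\langle\beta_i\rangle_b=b-\mathrm{Eval}(b,K^i_b,m_i)$, a sharing of $\beta_i=1-[d_i<0]$, and output $\langle y\rangle_b=b\,T_0+\sum_{i=1}^n\langle\beta_i\rangle_b(T_i-T_{i-1})$. The view of $P_b$ consists of its input shares, its shares of the $\alpha_i$, its keys, and the messages received from $P_{1-b}$. **Theorem.** Assume that the DCF is correct and secure. Then $\Pi_{\mathrm{LUT}_\delta^n}$ and $\Pi_{\mathrm{LUT}_w^n}$ are simulation-secure against a static semi-honest adversary corrupting one of the two parties. That is, for each protocol and each $b\in\{0,1\}$ there is a PPT simulator $\mathcal S_b$, given only $1^\lambda,1^\ell$ and the input shares of $P_b$, which outputs a view of $P_b$ such that: 1. In the simulated view the opened values $m_1,\dots,m_n$ are uniform in $R^n$ and independent of the simulated $\langle\alpha_i\rangle_b$ and keys. 2. On all admissible inputs, $(\text{view}_b,\langle y\rangle_0,\langle y\rangle_1)\approx_c(\mathcal S_b,\,y_0,\,y_1)$. Here $y_b$ is the output share determined by the simulated view, and $y_0+y_1$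 is the ideal output: the encoding of $\delta'(\tilde x/2^f)$, respectively of $w'(\tilde G/2^f,\tilde H/2^f)$. Admissible means that the integers $d_i$, computed from signed values, lie in $[-2^{\ell-1},2^{\ell-1})$ for $1\le i\le n$ and, for the leaf weight, that also $\tilde H>0$. 3. On all inputs, admissible or not, $\text{view}_b\approx_c\mathcal S_b$. -/

import Mathlib

namespace GuardGBDT

noncomputable section

/-! ## Probabilistic polynomial time

The machine model is a structured register machine.  Registers hold natural numbers (equivalently, bit
strings), every instruction is charged according to the bit lengths of its operands, and `rand` draws
fresh coins at a cost of one step per coin.  A loop reads its number of iterations on entry, so a program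
always halts; a polynomial time bound still has to be established for the total cost.  Since `size`
and the arithmetic instructions let a program compute a clock, every polynomially clocked probabilistic
Turing machine can be simulated (two numbers per tape) with polynomial cost, and conversely. -/

/-- Contents of the registers. -/
abbrev Store := ℕ → ℕ

/-- Binary arithmetic operations on natural numbers (`sub` is truncated). -/
inductive Op
  | add | sub | mul | div | mod

def Op.eval : Op → ℕ → ℕ → ℕ
  | .add, x, y => x + y
  | .sub, x, y => x - y
  | .mul, x, y => x * y
  | .div, x, y => x / y
  | .mod, x, y => x % y

/-- Programs; `d`, `a`, `b`, `r` are register numbers. -/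
inductive Prog
  /-- `d := c` -/
  | const (d c : ℕ)
  /-- `d := a ∘ b` -/
  | op (o : Op) (d a b : ℕ)
  /-- `d :=` bit length of `a` -/
  | size (d a : ℕ)
  /-- `d :=` a uniformly random number with `a` bits, i.e. a uniform element of `[0, 2 ^ a)` -/
  | rand (d a : ℕ)
  | seq (p q : Prog)
  /-- `if r ≠ 0 then p else q` -/
  | ite (r : ℕ) (p q : Prog)
  /-- execute `p` as many times as the value of `r` on entry -/
  | loop (r : ℕ) (p : Prog)

/-- Execution: the joint distribution of the final store and of the number of steps. -/
def Prog.run : Prog → Store → PMF (Store × ℕ)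
  | .const d c, s => PMF.pure (Function.update s d c, 1 + c.size)
  | .op o d a b, s =>
      PMF.pure (Function.update s d (o.eval (s a) (s b)), (1 + (s a).size) * (1 + (s b).size))
  | .size d a, s => PMF.pure (Function.update s d (s a).size, 1 + (s a).size)
  | .rand d a, s =>
      (PMF.uniformOfFintype (Fin (2 ^ s a))).map fun v => (Function.update s d v.val, 1 + s a)
  | .seq p q, s => (p.run s).bind fun o => (q.run o.1).map fun o' => (o'.1, o.2 + o'.2)
  | .ite r p q, s =>
      (if s r ≠ 0 then p.run s else q.run s).map fun o => (o.1, 1 + (s r).size + o.2)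
  | .loop r p, s =>
      Nat.rec (PMF.pure (s, 1 + (s r).size))
        (fun _ ih => ih.bind fun o => (p.run o.1).map fun o' => (o'.1, o.2 + 1 + o'.2)) (s r)

/-- The initial store: the input in the first registers, all other registers zero. -/
def initStore (input : List ℕ) : Store := fun i => input.getD i 0

/-- The distribution of the output, which is read from the first `m` registers. -/
def Prog.output (p : Prog) (m : ℕ) (input : List ℕ) : PMF (List ℕ) :=
  (p.run (initStore input)).map fun o => (List.range m).map o.1

/-- Total bit length of a list of numbers. -/
def bitLength (xs : List ℕ) : ℕ := (xs.map Nat.size).sum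

/-- `p` is a (strictly) probabilistic polynomial time algorithm with `k` inputs besides the public
parameters `1 ^ lam` and `1 ^ ℓ`: on every input and for all outcomes of its coins, its number of steps is
polynomially bounded. -/
def PolyTime (k : ℕ) (p : Prog) : Prop :=
  ∃ q : Polynomial ℕ, ∀ (lam ℓ : ℕ) (xs : List ℕ), xs.length = k →
    ∀ o ∈ (p.run (initStore (lam :: ℓ :: xs))).support, o.2 ≤ q.eval (lam + ℓ + bitLength xs)

def PolyBounded (g : ℕ → ℕ) : Prop := ∃ q : Polynomial ℕ, ∀ lam, g lam ≤ q.eval lam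

/-! ## Computational indistinguishability -/

/-- Negligible: eventually smaller than every inverse polynomial. -/
def Negligible (μ : ℕ → ℝ) : Prop :=
  Asymptotics.SuperpolynomialDecay Filter.atTop (fun lam : ℕ => (lam : ℝ)) μ

/-- The probability that `D`, given the public parameters, the advice `z` and a sample of `X`, outputs `1`. -/
def accept (D : Prog) (lam ℓ : ℕ) (z : List ℕ) (X : PMF (List ℕ)) : ℝ :=
  ((X.bind fun s => D.output 1 (lam :: ℓ :: (z ++ s))) [1]).toReal

/-- Computational indistinguishability `X ≈ Y` of two ensembles of `m`-tuples, indexed by the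
security parameter `lam` and by inputs `i : ι lam`, against non-uniform probabilistic polynomial time
distinguishers: programs with an advice (of any fixed number `a` of registers) of polynomial length. -/
def CompIndist (L : ℕ → ℕ) (m : ℕ) {ι : ℕ → Type} (X Y : ∀ lam, ι lam → PMF (List ℕ)) : Prop :=
  ∀ (a : ℕ) (D : Prog) (z : ℕ → List ℕ), PolyTime (a + m) D →
    (∀ lam, (z lam).length = a) → PolyBounded (fun lam => bitLength (z lam)) →
    ∃ μ : ℕ → ℝ, Negligible μ ∧ ∀ lam (i : ι lam),
      |accept D lam (L lam) (z lam) (X lam i) - accept D lam (L lam) (z lam) (Y lam i)| ≤ μ lam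

/-! ## The ring `ℤ / 2 ^ ℓ` and the distributed comparison function -/

abbrev Ring2 (ℓ : ℕ) := ZMod (2 ^ ℓ)

/-- The signed (two's complement) value of a ring element, in `[-2 ^ (ℓ - 1), 2 ^ (ℓ - 1))`. -/
def signed {ℓ : ℕ} (z : Ring2 ℓ) : ℤ :=
  if 2 * z.val < 2 ^ ℓ then (z.val : ℤ) else (z.val : ℤ) - 2 ^ ℓ

/-- The comparison function with threshold `α`: it decides `m < α`, where the difference `m - α` is read
as a signed `ℓ`-bit number (so at a masked point `m = d + α` it decides `d < 0`). -/
def less {ℓ : ℕ} (α m : Ring2 ℓ) : Ring2 ℓ := if signed (m - α) < 0 then 1 else 0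

/-- The syntax of a function secret sharing scheme for the comparison functions `less α`: efficient
algorithms `gen` (inputs `1 ^ lam`, `1 ^ ℓ`, `α`; output two keys) and `eval` (inputs `1 ^ lam`, `1 ^ ℓ`,
the index `b` of the party, its key and the public point `m`; output a share).  Evaluation is
deterministic; `share` is the function that `eval` computes. -/
structure DCF where
  gen : Prog
  eval : Prog
  share : (lam ℓ : ℕ) → Fin 2 → (key m : ℕ) → ℕ
  gen_polyTime : PolyTime 1 gen
  eval_polyTime : PolyTime 3 eval
  eval_output : ∀ (lam ℓ : ℕ) (b : Fin 2) (key m : ℕ),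
    eval.output 1 [lam, ℓ, b, key, m] = PMF.pure [share lam ℓ b key m]

/-- The distribution of the pair of keys `Gen(1 ^ lam, α)`. -/
def DCF.genKeys (Φ : DCF) (lam : ℕ) {ℓ : ℕ} (α : Ring2 ℓ) : PMF (Fin 2 → ℕ) :=
  (Φ.gen.run (initStore [lam, ℓ, α.val])).map fun o b => o.1 b

/-- The share `Eval(b, K_b, m)` as a ring element. -/
def DCF.evalShare (Φ : DCF) (lam : ℕ) {ℓ : ℕ} (b : Fin 2) (key : ℕ) (m : Ring2 ℓ) : Ring2 ℓ :=
  (Φ.share lam ℓ b key m.val : Ring2 ℓ)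

/-- Correctness: the two shares always add up to the value of the comparison function. -/
def DCF.Correct (Φ : DCF) (L : ℕ → ℕ) : Prop :=
  ∀ (lam : ℕ) (α : Ring2 (L lam)), ∀ K ∈ (Φ.genKeys lam α).support, ∀ m : Ring2 (L lam),
    Φ.evalShare lam 0 (K 0) m + Φ.evalShare lam 1 (K 1) m = less α m

/-- Security: each single key can be simulated in polynomial time from the public parameters alone. -/
def DCF.Secure (Φ : DCF) (L : ℕ → ℕ) : Prop :=
  ∀ b : Fin 2, ∃ Sim : Prog, PolyTime 0 Sim ∧
    CompIndist L 1 (ι := fun lam => Ring2 (L lam))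
      (fun lam α => (Φ.genKeys lam α).map fun K => [K b])
      (fun lam _ => Sim.output 1 [lam, L lam])

/-! ## The lookup-table protocols

Both protocols are instances of one scheme: for `i = 1, …, n` the parties open `d_i + α_i`, where `d_i` is a
public affine form in the `k` secret-shared inputs, they evaluate the `i`-th comparison key at the opened
value, and combine the resulting shares linearly with the differences of consecutive table entries. -/

/-- The public data: `d_i = ∑ j, coeff i j * x j + offset i` (position `i : Fin n` stands for the
knot with number `i + 1`) and the table entries `T_0, …, T_n`. -/
structure LUT (ℓ n k : ℕ) where
  coeff : Fin n → Fin k → Ring2 ℓ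
  offset : Fin n → Ring2 ℓ
  table : Fin (n + 1) → Ring2 ℓ

/-- What the dealer hands out for one index `i`: the shares of `α_i` and the two comparison keys. -/
structure Dealt (ℓ : ℕ) where
  alpha : Fin 2 → Ring2 ℓ
  key : Fin 2 → ℕ

/-- One iteration of the offline phase: `α ← ℤ / 2 ^ ℓ`, `(K_0, K_1) ← Gen(α)`, `⟨α⟩ ← Share(α)`. -/
def deal (Φ : DCF) (lam ℓ : ℕ) : PMF (Dealt ℓ) :=
  (PMF.uniformOfFintype (Ring2 ℓ)).bind fun α =>
    (Φ.genKeys lam α).bind fun K =>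
      (PMF.uniformOfFintype (Ring2 ℓ)).map fun r => ⟨![α - r, r], K⟩

/-- `n` independent samples. -/
def iid {β : Type} (μ : PMF β) : (n : ℕ) → PMF (Fin n → β)
  | 0 => PMF.pure Fin.elim0
  | n + 1 => μ.bind fun x => (iid μ n).map fun f => Fin.cons x f

/-- The view of one party: its shares of the inputs, what it received from the dealer for
`i = 0, …, n`, and the message received from the other party for `i = 1, …, n`.  (The parties use no
further randomness.) -/
structure View (ℓ n k : ℕ) where
  input : Fin k → Ring2 ℓ
  alpha : Fin (n + 1) → Ring2 ℓ
  key : Fin (n + 1) → ℕ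
  received : Fin n → Ring2 ℓ

def View.toList {ℓ n k : ℕ} (v : View ℓ n k) : List ℕ :=
  List.ofFn (fun j => (v.input j).val) ++ List.ofFn (fun i => (v.alpha i).val) ++
    List.ofFn v.key ++ List.ofFn (fun i => (v.received i).val)

/-- The length of `View.toList`. -/
def viewLength (n k : ℕ) : ℕ := k + (n + 1) + (n + 1) + n

/-- Party `b`'s share of `d_i + α_i`; public constants are added by party `1` only. -/
def LUT.masked {ℓ n k : ℕ} (P : LUT ℓ n k) (b : Fin 2) (x : Fin k → Ring2 ℓ)
    (alpha : Fin (n + 1) → Ring2 ℓ) (i : Fin n) : Ring2 ℓ :=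
  ∑ j, P.coeff i j * x j + alpha i.succ + (b.val : Ring2 ℓ) * P.offset i

/-- The opened value `m_i` as party `b` computes it from its view. -/
def LUT.opened {ℓ n k : ℕ} (P : LUT ℓ n k) (b : Fin 2) (v : View ℓ n k) (i : Fin n) : Ring2 ℓ :=
  P.masked b v.input v.alpha i + v.received i

/-- Party `b`'s share of `1 - [d_i < 0]`, the bit saying whether the `i`-th knot has been reached. -/
def LUT.bitShare {ℓ n k : ℕ} (P : LUT ℓ n k) (Φ : DCF) (lam : ℕ) (b : Fin 2) (v : View ℓ n k)
    (i : Fin n) : Ring2 ℓ :=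
  (b.val : Ring2 ℓ) - Φ.evalShare lam b (v.key i.succ) (P.opened b v i)

/-- Party `b`'s output share of `T_0 + ∑ i, β_i * (T_i - T_{i-1})`. -/
def LUT.outputShare {ℓ n k : ℕ} (P : LUT ℓ n k) (Φ : DCF) (lam : ℕ) (b : Fin 2) (v : View ℓ n k) :
    Ring2 ℓ :=
  (b.val : Ring2 ℓ) * P.table 0 +
    ∑ i : Fin n, P.bitShare Φ lam b v i * (P.table i.succ - P.table i.castSucc)

/-- Party `b`'s view in the execution on the input shares `x 0`, `x 1` with dealt material `o`
(`1 - b : Fin 2` is the other party). -/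
def LUT.realView {ℓ n k : ℕ} (P : LUT ℓ n k) (x : Fin 2 → Fin k → Ring2 ℓ)
    (o : Fin (n + 1) → Dealt ℓ) (b : Fin 2) : View ℓ n k where
  input := x b
  alpha := fun i => (o i).alpha b
  key := fun i => (o i).key b
  received := P.masked (1 - b) (x (1 - b)) (fun i => (o i).alpha (1 - b))

/-- The real experiment: the view of party `b` together with the outputs of both parties. -/
def LUT.real {ℓ n k : ℕ} (P : LUT ℓ n k) (Φ : DCF) (lam : ℕ) (b : Fin 2)
    (x : Fin 2 → Fin k → Ring2 ℓ) : PMF (List ℕ) :=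
  (iid (deal Φ lam ℓ) (n + 1)).map fun o =>
    (P.realView x o b).toList ++
      [(P.outputShare Φ lam 0 (P.realView x o 0)).val, (P.outputShare Φ lam 1 (P.realView x o 1)).val]

/-- The view of party `b` alone in the real experiment. -/
def LUT.realViewOnly {ℓ n k : ℕ} (P : LUT ℓ n k) (Φ : DCF) (lam : ℕ) (b : Fin 2)
    (x : Fin 2 → Fin k → Ring2 ℓ) : PMF (List ℕ) :=
  (iid (deal Φ lam ℓ) (n + 1)).map fun o => (P.realView x o b).toList

/-- The ideal experiment: a simulated view of party `b`, together with a sharing of the ideal output `y`: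
the corrupted party's share is the one determined by its (simulated) view, and the honest party
receives the complementary share. -/
def LUT.ideal {ℓ n k : ℕ} (P : LUT ℓ n k) (Φ : DCF) (lam : ℕ) (b : Fin 2)
    (V : PMF (View ℓ n k)) (y : Ring2 ℓ) : PMF (List ℕ) :=
  V.map fun v =>
    let own := P.outputShare Φ lam b v
    v.toList ++ (if b = 0 then [own.val, (y - own).val] else [(y - own).val, own.val])

/-- The family of protocols `P` securely computes, on secret-shared inputs, the functions `F` on the
admissible inputs `Adm`, in the presence of a static semi-honest adversary corrupting one party `b`.
The simulator `S` is given the public parameters and the corrupted party's input shares only; `V` is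
the distribution of the view that it outputs.  In the simulated view the opened values are uniform
ring elements, independent of the simulated dealer's messages.  The last two clauses compare real and ideal:
the joint distribution of view and outputs on admissible inputs, and the view alone on all inputs. -/
def SecurelyComputes (Φ : DCF) (L : ℕ → ℕ) {n k : ℕ} (P : ∀ lam, LUT (L lam) n k)
    (F : ∀ lam, (Fin k → Ring2 (L lam)) → Ring2 (L lam))
    (Adm : ∀ lam, (Fin k → Ring2 (L lam)) → Prop) : Prop :=
  ∀ b : Fin 2, ∃ (S : Prog) (V : ∀ lam, (Fin k → Ring2 (L lam)) → PMF (View (L lam) n k)),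
    PolyTime k S ∧
    (∀ lam (xb : Fin k → Ring2 (L lam)),
      S.output (viewLength n k) (lam :: L lam :: List.ofFn fun j => (xb j).val) =
        (V lam xb).map View.toList) ∧
    (∀ lam (xb : Fin k → Ring2 (L lam)),
      ((V lam xb).map fun v => ((v.alpha, v.key), (P lam).opened b v)) =
        ((V lam xb).map fun v => (v.alpha, v.key)).bind fun c =>
          (PMF.uniformOfFintype (Fin n → Ring2 (L lam))).map fun r => (c, r)) ∧
    CompIndist L (viewLength n k + 2)
      (ι := fun lam => {x : Fin 2 → Fin k → Ring2 (L lam) // Adm lam (x 0 + x 1)})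
      (fun lam x => (P lam).real Φ lam b x.1)
      (fun lam x => (P lam).ideal Φ lam b (V lam (x.1 b)) (F lam (x.1 0 + x.1 1))) ∧
    CompIndist L (viewLength n k) (ι := fun lam => Fin 2 → Fin k → Ring2 (L lam))
      (fun lam x => (P lam).realViewOnly Φ lam b x)
      (fun lam x => (V lam (x b)).map View.toList)

/-! ## The approximated sigmoid and the approximated leaf weight -/

/-- Fixed-point encoding with `f` fractional bits (rounding down). -/
def fixedPoint (f : ℕ) (v : ℝ) : ℤ := ⌊v * 2 ^ f⌋

/-- The real number that a ring element represents. -/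
def decode (f : ℕ) {ℓ : ℕ} (z : Ring2 ℓ) : ℝ := (signed z : ℝ) / 2 ^ f

/-- The knots `ω_i = -5 + 10 i / n`. -/
def knot (n i : ℕ) : ℝ := -5 + 10 * i / n

/-- The knots as fixed-point numbers. -/
def knotFixed (f n i : ℕ) : ℝ := (fixedPoint f (knot n i) : ℝ) / 2 ^ f

open Classical in
/-- The number of the segment that contains `t`: the greatest `i ≤ n` with `ω_i ≤ t`, and `0` if `t < ω_0`. -/
def segmentIndex (f n : ℕ) (t : ℝ) : ℕ := Nat.findGreatest (fun i => knotFixed f n i ≤ t) n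

/-- The approximated sigmoid `δ'`: constant on every segment. -/
def approxSigmoid (f n : ℕ) (t : ℝ) : ℝ := Real.sigmoid (knot n (segmentIndex f n t))

/-- The approximated leaf weight `w'` for the gradient sums `G` and `H`. -/
def approxWeight (f n : ℕ) (G H : ℝ) : ℝ := knot n (segmentIndex f n (-G / H))

/-- The integer `d` lies in the range of signed `ℓ`-bit numbers. -/
def InRange (ℓ : ℕ) (d : ℤ) : Prop := -2 ^ ℓ ≤ 2 * d ∧ 2 * d < 2 ^ ℓ

/-- Sigmoid protocol: `d_i = x - ω_i` and `T_i = δ(ω_i)`. -/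
def sigmoidLUT (ℓ f n : ℕ) : LUT ℓ n 1 where
  coeff := fun _ _ => 1
  offset := fun i => -(fixedPoint f (knot n (i + 1)) : Ring2 ℓ)
  table := fun i => (fixedPoint f (Real.sigmoid (knot n i)) : Ring2 ℓ)

def sigmoidIdeal (ℓ f n : ℕ) (x : Fin 1 → Ring2 ℓ) : Ring2 ℓ :=
  (fixedPoint f (approxSigmoid f n (decode f (x 0))) : Ring2 ℓ)

/-- The differences `x - ω_i` do not overflow. -/
def sigmoidAdm (ℓ f n : ℕ) (x : Fin 1 → Ring2 ℓ) : Prop :=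
  ∀ i ∈ Finset.Icc 1 n, InRange ℓ (signed (x 0) - fixedPoint f (knot n i))

/-- Leaf weight protocol, with inputs `G = x 0` and `H = x 1`: `d_i = -G - ω_i * H` and `T_i = ω_i`.  The product
of the fixed-point numbers `ω_i` and `H` has `2 f` fractional bits, so `G` is multiplied by the encoding
`2 ^ f` of `1`. -/
def leafLUT (ℓ f n : ℕ) : LUT ℓ n 2 where
  coeff := fun i => ![-(2 ^ f), -(fixedPoint f (knot n (i + 1)) : Ring2 ℓ)]
  offset := fun _ => 0
  table := fun i => (fixedPoint f (knot n i) : Ring2 ℓ)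

def leafIdeal (ℓ f n : ℕ) (x : Fin 2 → Ring2 ℓ) : Ring2 ℓ :=
  (fixedPoint f (approxWeight f n (decode f (x 0)) (decode f (x 1))) : Ring2 ℓ)

/-- The denominator `H` is positive and the values `-G - ω_i * H` do not overflow. -/
def leafAdm (ℓ f n : ℕ) (x : Fin 2 → Ring2 ℓ) : Prop :=
  0 < signed (x 1) ∧
    ∀ i ∈ Finset.Icc 1 n, InRange ℓ (-(2 ^ f * signed (x 0)) - fixedPoint f (knot n i) * signed (x 1))

end

end GuardGBDT

namespace GuardGBDT

/-! ## Probability mass functions -/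

/-! Correctness rests on a telescoping sum. The opened value is `d_i + α_i`, so the keys share the
bit `[d_i < 0]`. The knots increase, hence `β_i = 1` exactly for `i` up to the segment index `I`,
and the differences `T_i - T_{i-1}` add up to `T_I - T_0` (`LUT.outputShare_add`, `sigmoid_diff`,
`leaf_diff`). On admissible inputs the two output shares therefore have a fixed sum, and the honest
share is a function of the corrupted view (`LUT.real_eq`).

For privacy, the view of one party is a function `LUT.viewOf` of `n + 1` independent triples: its
share of `α_i`, the mask `α_i` itself and its key. The share alone is uniform and independent of
mask and key (`deal_restrict`). Once the keys no longer depend on the masks, the masks act as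
one-time pads on the received messages, so the view is exactly the simulated one (`simView_eq`). The
only computational step is the replacement of the keys.

The keys are replaced one at a time (`gap_iid_le`). In each hybrid step everything except one key is
fixed and becomes the advice of a distinguisher against the DCF. The output share is affine in the
evaluation of that key at a fixed point (`LUT.outputShare_setKey`), so a program with a fixed number
of registers of advice rebuilds view and outputs from the challenge (`exists_reduction`). The fixed
data vary with inputs and coins, which requires a bound uniform over all advice of polynomial
length; choosing a nearly optimal advice for each security parameter supplies it
(`CompIndist.uniform_advice`). The advice contains the other keys; they are short because a program
pays for the bits it writes (`Prog.size_le`).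

`compIndist_withOutputs` combines these steps for an arbitrary value `y` in place of the ideal
output; correctness enters only to identify the real experiment. The work on programs shows that
simulator and reduction, which call given algorithms as subroutines, again run in polynomial time.
-/

theorem bind_congr_support {α β : Type*} {p : PMF α} {g h : α → PMF β}
    (hgh : ∀ a ∈ p.support, g a = h a) : p.bind g = p.bind h := by
  ext b
  rw [PMF.bind_apply, PMF.bind_apply]
  refine tsum_congr fun a => ?_
  by_cases ha : a ∈ p.support
  · rw [hgh a ha]
  · rw [PMF.mem_support_iff, not_not] at ha
    simp [ha]

theorem map_congr_support {α β : Type*} {p : PMF α} {f g : α → β}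
    (h : ∀ a ∈ p.support, f a = g a) : p.map f = p.map g := by
  exact bind_congr_support fun a ha => by simp [h a ha]

theorem uniform_map_of_bijective {α β : Type*} [Fintype α] [Nonempty α] [Fintype β] [Nonempty β]
    (e : α → β) (he : Function.Bijective e) :
    (PMF.uniformOfFintype α).map e = PMF.uniformOfFintype β := by
  classical
  ext b
  obtain ⟨a, rfl⟩ := he.2 b
  rw [PMF.map_apply, tsum_eq_single a]
  · simp [Fintype.card_of_bijective he]
  · intro a' ha'
    rw [if_neg]
    exact fun h => ha' (he.1 h).symm

theorem uniform_bind_eq_of_bijective {α β γ : Type*} [Fintype α] [Nonempty α] [Fintype β]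
    [Nonempty β] (e : α → β) (he : Function.Bijective e) (g : β → PMF γ) :
    (PMF.uniformOfFintype α).bind (fun a => g (e a)) = (PMF.uniformOfFintype β).bind g := by
  rw [← uniform_map_of_bijective e he, PMF.bind_map]
  rfl

theorem iid_map {β γ : Type} (μ : PMF β) (f : β → γ) (n : ℕ) :
    (iid μ n).map (fun o i => f (o i)) = iid (μ.map f) n := by
  induction n with
  | zero =>
    simp only [iid, PMF.pure_map]
    congr 1
    exact Subsingleton.elim _ _
  | succ n ih =>
    simp only [iid, PMF.map_bind, PMF.bind_map, PMF.map_comp, ← ih]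
    congr 1
    funext x
    simp only [Function.comp_apply]
    congr 1
    funext o i
    refine Fin.cases ?_ (fun i => ?_) i <;> simp

theorem mem_support_iid {β : Type} {μ : PMF β} {n : ℕ} {o : Fin n → β}
    (h : o ∈ (iid μ n).support) (i : Fin n) : o i ∈ μ.support := by
  induction n with
  | zero => exact i.elim0
  | succ n ih =>
    simp only [iid, PMF.mem_support_bind_iff, PMF.mem_support_map_iff] at h
    obtain ⟨x, hx, o', ho', rfl⟩ := h
    refine Fin.cases ?_ (fun i => ?_) i
    · simpa using hx
    · simpa using ih ho' i

/-- Samples of a joint distribution whose first component is drawn first. -/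
theorem iid_bind_map {β γ δ : Type} (μ : PMF β) (ν : PMF γ) (f : β → γ → δ) (n : ℕ) :
    iid (μ.bind fun a => ν.map (f a)) n =
      (iid μ n).bind fun a => (iid ν n).map fun c i => f (a i) (c i) := by
  induction n with
  | zero =>
    simp only [iid, PMF.pure_bind, PMF.pure_map]
    congr 1
    exact Subsingleton.elim _ _
  | succ n ih =>
    simp only [iid, ih, PMF.map_bind, PMF.bind_bind, PMF.bind_map, PMF.map_comp,
      Function.comp_def]
    congr 1
    funext a
    rw [PMF.bind_comm]
    congr 1
    funext a'
    congr 1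
    funext c
    congr 1
    funext c' i
    refine Fin.cases ?_ (fun i => ?_) i <;> simp

/-- Serves to discard the mask with index `0`, which is dealt but never opened. -/
theorem iid_tail {β : Type} (μ : PMF β) (n : ℕ) :
    (iid μ (n + 1)).map (fun o i => o i.succ) = iid μ n := by
  simp only [iid, PMF.map_bind, PMF.map_comp, Function.comp_def, Fin.cons_succ]
  rw [PMF.bind_const]
  exact PMF.map_id _

theorem iid_uniform (β : Type) [Fintype β] [Nonempty β] (n : ℕ) :
    iid (PMF.uniformOfFintype β) n = PMF.uniformOfFintype (Fin n → β) := by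
  classical
  induction n with
  | zero =>
    ext o
    simp [iid, Subsingleton.elim o Fin.elim0]
  | succ n ih =>
    ext o
    simp only [iid, ih, PMF.bind_apply, PMF.map_apply]
    rw [tsum_eq_single (o 0), tsum_eq_single (fun i => o i.succ)]
    · rw [if_pos (by exact (Fin.cons_self_tail o).symm)]
      simp only [PMF.uniformOfFintype_apply, Fintype.card_fun, Fintype.card_fin]
      rw [← ENNReal.mul_inv (by simp) (by simp)]
      push_cast
      rw [pow_succ']
    · intro o' ho'
      rw [if_neg]
      rintro h
      exact ho' (by rw [h]; simp)
    · intro x hx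
      rw [ENNReal.tsum_eq_zero.2, mul_zero]
      intro o'
      rw [if_neg]
      rintro h
      exact hx (by rw [h]; simp)

/-! ## The gap between two distributions at a point -/

noncomputable def gap {β : Type*} (p q : PMF β) (y : β) : ℝ := |(p y).toReal - (q y).toReal|

theorem gap_triangle {β : Type*} (p q r : PMF β) (y : β) : gap p r y ≤ gap p q y + gap q r y :=
  abs_sub_le _ _ _

theorem gap_nonneg {β : Type*} (p q : PMF β) (y : β) : 0 ≤ gap p q y := abs_nonneg _

theorem gap_le_one {β : Type*} (p q : PMF β) (y : β) : gap p q y ≤ 1 := by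
  have hp := ENNReal.toReal_mono ENNReal.one_ne_top (p.coe_le_one y)
  have hq := ENNReal.toReal_mono ENNReal.one_ne_top (q.coe_le_one y)
  have hp' := @ENNReal.toReal_nonneg (p y)
  have hq' := @ENNReal.toReal_nonneg (q y)
  rw [ENNReal.toReal_one] at hp hq
  rw [gap, abs_le]
  constructor <;> linarith

theorem bind_toReal_le {α β : Type*} (p : PMF α) (g h : α → PMF β) (y : β) (ε : ℝ) (hε : 0 ≤ ε)
    (hgh : ∀ a ∈ p.support, (g a y).toReal ≤ (h a y).toReal + ε) :
    ((p.bind g) y).toReal ≤ ((p.bind h) y).toReal + ε := by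
  -- In `ENNReal` the series can be compared without any summability conditions.
  have key : (p.bind g) y ≤ (p.bind h) y + ENNReal.ofReal ε := by
    rw [PMF.bind_apply, PMF.bind_apply]
    calc ∑' a, p a * g a y ≤ ∑' a, (p a * h a y + p a * ENNReal.ofReal ε) := by
          refine ENNReal.tsum_le_tsum fun a => ?_
          by_cases ha : a ∈ p.support
          · rw [← mul_add]
            gcongr
            have := ENNReal.ofReal_le_ofReal (hgh a ha)
            rwa [ENNReal.ofReal_add ENNReal.toReal_nonneg hε,
              ENNReal.ofReal_toReal (PMF.apply_ne_top _ _),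
              ENNReal.ofReal_toReal (PMF.apply_ne_top _ _)] at this
          · rw [PMF.mem_support_iff, not_not] at ha
            simp [ha]
      _ = _ := by rw [ENNReal.tsum_add, ENNReal.tsum_mul_right, p.tsum_coe, one_mul]
  have := ENNReal.toReal_mono (ENNReal.add_ne_top.2 ⟨PMF.apply_ne_top _ _, ENNReal.ofReal_ne_top⟩) key
  rwa [ENNReal.toReal_add (PMF.apply_ne_top _ _) ENNReal.ofReal_ne_top,
    ENNReal.toReal_ofReal hε] at this

/-- An average is bounded by the worst case. This is what allows common randomness to be fixed
before a reduction is applied. -/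
theorem gap_bind_le {α β : Type*} (p : PMF α) (g h : α → PMF β) (y : β) (ε : ℝ)
    (hgh : ∀ a ∈ p.support, gap (g a) (h a) y ≤ ε) : gap (p.bind g) (p.bind h) y ≤ ε := by
  obtain ⟨a, ha⟩ := p.support_nonempty
  have hε : 0 ≤ ε := (gap_nonneg _ _ _).trans (hgh a ha)
  rw [gap, abs_sub_le_iff]
  constructor
  · have := bind_toReal_le p g h y ε hε fun a ha => by
      have := (abs_sub_le_iff.1 (hgh a ha)).1
      linarith
    linarith
  · have := bind_toReal_le p h g y ε hε fun a ha => by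
      have := (abs_sub_le_iff.1 (hgh a ha)).2
      linarith
    linarith

/-- The hybrid argument: samples are exchanged one after the other. -/
theorem gap_iid_le {β : Type} {γ : Type*} (P Q : PMF β) (Good : Set β) (hP : P.support ⊆ Good)
    (hQ : Q.support ⊆ Good) (y : γ) (n : ℕ) (g : (Fin n → β) → PMF γ) (ε : Fin n → ℝ)
    (h : ∀ (j : Fin n) (o : Fin n → β), (∀ i, o i ∈ Good) →
      gap (P.bind fun c => g (Function.update o j c))
        (Q.bind fun c => g (Function.update o j c)) y ≤ ε j) :
    gap ((iid P n).bind g) ((iid Q n).bind g) y ≤ ∑ j, ε j := by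
  induction n with
  | zero => simp [iid, gap]
  | succ n ih =>
    -- A filler for position `0`, overwritten by the update; it only has to lie in `Good`.
    obtain ⟨c₀, hc₀⟩ := P.support_nonempty
    rw [Fin.sum_univ_succ, add_comm (ε 0)]
    simp only [iid, PMF.bind_bind, PMF.bind_map, Function.comp_def]
    -- The intermediate hybrid has its first entry from `P` and all later entries from `Q`.
    refine (gap_triangle _ (P.bind fun c => (iid Q n).bind fun o => g (Fin.cons c o)) _ y).trans
      (add_le_add ?_ ?_)
    · refine gap_bind_le _ _ _ _ _ fun c hc => ?_
      refine ih (fun o => g (Fin.cons c o)) _ fun j o ho => ?_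
      have := h j.succ (Fin.cons c o) (Fin.cases (hP hc) ho)
      simpa only [Fin.cons_update] using this
    · rw [PMF.bind_comm P, PMF.bind_comm Q]
      refine gap_bind_le _ _ _ _ _ fun o ho => ?_
      have := h 0 (Fin.cons c₀ o) (Fin.cases (hP hc₀) fun i => hQ (mem_support_iid ho i))
      simpa only [Fin.update_cons_zero] using this

/-! ## Programs -/

namespace Prog

/-- Execution without the number of steps. -/
noncomputable def exec (p : Prog) (s : Store) : PMF Store := (p.run s).map Prod.fst

theorem exec_const (d c : ℕ) (s : Store) :
    (Prog.const d c).exec s = PMF.pure (Function.update s d c) := by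
  simp [exec, run, PMF.pure_map]

theorem exec_op (o : Op) (d a b : ℕ) (s : Store) :
    (Prog.op o d a b).exec s = PMF.pure (Function.update s d (o.eval (s a) (s b))) := by
  simp [exec, run, PMF.pure_map]

theorem exec_rand (d a : ℕ) (s : Store) :
    (Prog.rand d a).exec s =
      (PMF.uniformOfFintype (Fin (2 ^ s a))).map fun v => Function.update s d v.val := by
  simp [exec, run, PMF.map_comp, Function.comp_def]

theorem exec_seq (p q : Prog) (s : Store) : (p.seq q).exec s = (p.exec s).bind q.exec := by
  simp only [exec, run, PMF.map_bind, PMF.map_comp, PMF.bind_map, Function.comp_def]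

theorem output_eq (p : Prog) (m : ℕ) (input : List ℕ) :
    p.output m input = (p.exec (initStore input)).map fun s => (List.range m).map s := by
  simp only [output, exec, PMF.map_comp, Function.comp_def]

theorem mem_support_exec {p : Prog} {s t : Store} :
    t ∈ (p.exec s).support ↔ ∃ c, (t, c) ∈ (p.run s).support := by
  simp [exec]

/-- The loop body of `Prog.run`. -/
noncomputable def iter (p : Prog) (s : Store) (c n : ℕ) : PMF (Store × ℕ) :=
  Nat.rec (PMF.pure (s, c))
    (fun _ ih => ih.bind fun o => (p.run o.1).map fun o' => (o'.1, o.2 + 1 + o'.2)) n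

theorem run_loop (r : ℕ) (p : Prog) (s : Store) :
    (Prog.loop r p).run s = p.iter s (1 + (s r).size) (s r) := rfl

theorem iter_zero (p : Prog) (s : Store) (c : ℕ) : p.iter s c 0 = PMF.pure (s, c) := rfl

theorem iter_succ (p : Prog) (s : Store) (c n : ℕ) :
    p.iter s c (n + 1) =
      (p.iter s c n).bind fun o => (p.run o.1).map fun o' => (o'.1, o.2 + 1 + o'.2) := rfl

/-! ### Renaming registers -/

def rename (φ : ℕ → ℕ) : Prog → Prog
  | .const d c => .const (φ d) c
  | .op o d a b => .op o (φ d) (φ a) (φ b)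
  | .size d a => .size (φ d) (φ a)
  | .rand d a => .rand (φ d) (φ a)
  | .seq p q => .seq (p.rename φ) (q.rename φ)
  | .ite r p q => .ite (φ r) (p.rename φ) (q.rename φ)
  | .loop r p => .loop (φ r) (p.rename φ)

theorem extend_update {φ : ℕ → ℕ} (hφ : Function.Injective φ) (t s : Store) (d v : ℕ) :
    Function.extend φ (Function.update t d v) s =
      Function.update (Function.extend φ t s) (φ d) v := by
  funext r
  by_cases h : ∃ a, φ a = r
  · obtain ⟨a, rfl⟩ := h
    rw [hφ.extend_apply, Function.update_apply, Function.update_apply, hφ.extend_apply]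
    simp [hφ.eq_iff]
  · have hr : r ≠ φ d := fun e => h ⟨d, e.symm⟩
    rw [Function.extend_apply' _ _ _ h, Function.update_of_ne hr, Function.extend_apply' _ _ _ h]

theorem extend_comp_self {φ : ℕ → ℕ} (hφ : Function.Injective φ) (s : Store) :
    Function.extend φ (s ∘ φ) s = s := by
  funext r
  by_cases h : ∃ a, φ a = r
  · obtain ⟨a, rfl⟩ := h
    rw [hφ.extend_apply]
    rfl
  · rw [Function.extend_apply' _ _ _ h]

theorem extend_extend {φ : ℕ → ℕ} (hφ : Function.Injective φ) (t t' s : Store) :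
    Function.extend φ t (Function.extend φ t' s) = Function.extend φ t s := by
  funext r
  by_cases h : ∃ a, φ a = r
  · obtain ⟨a, rfl⟩ := h
    rw [hφ.extend_apply, hφ.extend_apply]
  · rw [Function.extend_apply' _ _ _ h, Function.extend_apply' _ _ _ h,
      Function.extend_apply' _ _ _ h]

/-- For injective `φ` distinct registers stay distinct, so the program acts on the image of `φ` as
the original does, at the same cost; registers outside the image are untouched. -/
theorem run_rename {φ : ℕ → ℕ} (hφ : Function.Injective φ) (p : Prog) (s : Store) :
    (p.rename φ).run s =
      (p.run (s ∘ φ)).map fun o => (Function.extend φ o.1 s, o.2) := by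
  induction p generalizing s with
  | const d c => simp [rename, run, PMF.pure_map, extend_update hφ, extend_comp_self hφ]
  | op o d a b => simp [rename, run, PMF.pure_map, extend_update hφ, extend_comp_self hφ]
  | size d a => simp [rename, run, PMF.pure_map, extend_update hφ, extend_comp_self hφ]
  | rand d a =>
    simp [rename, run, PMF.map_comp, Function.comp_def, extend_update hφ]
    simp only [← Function.comp_def s φ, extend_comp_self hφ]
  | seq p q ihp ihq =>
    simp only [rename, run, ihp, ihq, PMF.map_bind, PMF.bind_map, PMF.map_comp, Function.comp_def,
      extend_extend hφ, hφ.extend_apply]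
  | ite r p q ihp ihq =>
    simp only [rename, run, Function.comp_apply]
    by_cases h : s (φ r) ≠ 0
    · simp only [if_pos h, ihp, PMF.map_comp, Function.comp_def]
    · simp only [if_neg h, ihq, PMF.map_comp, Function.comp_def]
  | loop r p ih =>
    simp only [rename, run_loop, Function.comp_apply]
    generalize 1 + (s (φ r)).size = c
    generalize s (φ r) = n
    induction n with
    | zero => simp [iter_zero, PMF.pure_map, extend_comp_self hφ]
    | succ n ihn =>
      simp only [iter_succ, ihn, ih, PMF.map_bind, PMF.bind_map, PMF.map_comp, Function.comp_def,
        extend_extend hφ, hφ.extend_apply]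

/-! ### Registers that a program cannot reach, and the sizes of the registers -/

theorem mem_support_seq {p q : Prog} {s : Store} {o : Store × ℕ} :
    o ∈ ((p.seq q).run s).support ↔
      ∃ o₁ ∈ (p.run s).support, ∃ o₂ ∈ (q.run o₁.1).support, o = (o₂.1, o₁.2 + o₂.2) := by
  simp only [run, PMF.mem_support_bind_iff, PMF.mem_support_map_iff, eq_comm]

/-- A program text names finitely many registers. The bound tells a caller how much working space
has to be cleared after a subroutine. -/
theorem exists_frame (p : Prog) :
    ∃ B, ∀ s, ∀ o ∈ (p.run s).support, ∀ r, B ≤ r → o.1 r = s r := by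
  induction p with
  | const d c =>
    refine ⟨d + 1, fun s o ho r hr => ?_⟩
    simp only [run, PMF.mem_support_pure_iff] at ho
    subst ho
    exact Function.update_of_ne (by omega) _ _
  | op o d a b =>
    refine ⟨d + 1, fun s o ho r hr => ?_⟩
    simp only [run, PMF.mem_support_pure_iff] at ho
    subst ho
    exact Function.update_of_ne (by omega) _ _
  | size d a =>
    refine ⟨d + 1, fun s o ho r hr => ?_⟩
    simp only [run, PMF.mem_support_pure_iff] at ho
    subst ho
    exact Function.update_of_ne (by omega) _ _
  | rand d a =>
    refine ⟨d + 1, fun s o ho r hr => ?_⟩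
    simp only [run, PMF.mem_support_map_iff] at ho
    obtain ⟨v, -, rfl⟩ := ho
    exact Function.update_of_ne (by omega) _ _
  | seq p q ihp ihq =>
    obtain ⟨B, hB⟩ := ihp
    obtain ⟨C, hC⟩ := ihq
    refine ⟨max B C, fun s o ho r hr => ?_⟩
    obtain ⟨o₁, h₁, o₂, h₂, rfl⟩ := mem_support_seq.1 ho
    exact (hC _ _ h₂ r (by omega)).trans (hB _ _ h₁ r (by omega))
  | ite r p q ihp ihq =>
    obtain ⟨B, hB⟩ := ihp
    obtain ⟨C, hC⟩ := ihq
    refine ⟨max B C, fun s o ho r hr => ?_⟩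
    simp only [run, PMF.mem_support_map_iff] at ho
    obtain ⟨o₁, h₁, rfl⟩ := ho
    split_ifs at h₁
    · exact hB _ _ h₁ r (by omega)
    · exact hC _ _ h₁ r (by omega)
  | loop r p ih =>
    obtain ⟨B, hB⟩ := ih
    refine ⟨B, fun s o ho r hr => ?_⟩
    rw [run_loop] at ho
    revert ho
    generalize 1 + Nat.size _ = c
    generalize s _ = n
    intro ho
    induction n generalizing o with
    | zero =>
      rw [iter_zero, PMF.mem_support_pure_iff] at ho
      rw [ho]
    | succ n ihn =>
      simp only [iter_succ, PMF.mem_support_bind_iff, PMF.mem_support_map_iff] at ho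
      obtain ⟨o₁, h₁, o₂, h₂, rfl⟩ := ho
      exact (hB _ _ h₂ r hr).trans (ihn _ h₁)

/-- The right side is the cost charged for an operation, so no result is longer than its price. -/
theorem size_op_le (o : Op) (x y : ℕ) : (o.eval x y).size ≤ (1 + x.size) * (1 + y.size) := by
  have hx := Nat.lt_size_self x
  have hy := Nat.lt_size_self y
  have hmono : ∀ z ≤ x, z.size ≤ (1 + x.size) * (1 + y.size) := fun z hz =>
    (Nat.size_le_size hz).trans (by nlinarith [Nat.zero_le x.size, Nat.zero_le y.size])
  cases o with
  | add =>
    refine Nat.size_le.2 (?_ : x + y < _)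
    calc x + y < 2 ^ x.size + 2 ^ y.size := by omega
      _ ≤ 2 ^ (x.size + y.size) + 2 ^ (x.size + y.size) := by
        gcongr <;> omega
      _ = 2 ^ (x.size + y.size + 1) := by ring
      _ ≤ _ := Nat.pow_le_pow_right (by norm_num) (by nlinarith)
  | sub => exact hmono _ (Nat.sub_le x y)
  | mul =>
    refine Nat.size_le.2 (?_ : x * y < _)
    calc x * y < 2 ^ x.size * 2 ^ y.size := Nat.mul_lt_mul'' hx hy
      _ = 2 ^ (x.size + y.size) := by ring
      _ ≤ _ := Nat.pow_le_pow_right (by norm_num) (by nlinarith)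
  | div => exact hmono _ (Nat.div_le_self x y)
  | mod => exact hmono _ (Nat.mod_le x y)

theorem size_update_le {s : Store} {d v c : ℕ} (h : v.size ≤ c) (r : ℕ) :
    (Function.update s d v r).size ≤ max (s r).size c := by
  rw [Function.update_apply]
  split_ifs
  · exact h.trans (le_max_right _ _)
  · exact le_max_left _ _

/-- A register that is written to costs at least the number of bits written. -/
theorem size_le (p : Prog) (s : Store) :
    ∀ o ∈ (p.run s).support, ∀ r, (o.1 r).size ≤ max (s r).size o.2 := by
  induction p generalizing s with
  | const d c =>
    intro o ho r
    simp only [run, PMF.mem_support_pure_iff] at ho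
    subst ho
    exact size_update_le (by omega) r
  | op o d a b =>
    intro o ho r
    simp only [run, PMF.mem_support_pure_iff] at ho
    subst ho
    exact size_update_le (size_op_le _ _ _) r
  | size d a =>
    intro o ho r
    simp only [run, PMF.mem_support_pure_iff] at ho
    subst ho
    refine size_update_le ?_ r
    have : (s a).size.size ≤ (s a).size := Nat.size_le.2 Nat.lt_two_pow_self
    omega
  | rand d a =>
    intro o ho r
    simp only [run, PMF.mem_support_map_iff] at ho
    obtain ⟨v, -, rfl⟩ := ho
    refine size_update_le ?_ r
    have : v.val.size ≤ s a := Nat.size_le.2 v.isLt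
    omega
  | seq p q ihp ihq =>
    intro o ho r
    obtain ⟨o₁, h₁, o₂, h₂, rfl⟩ := mem_support_seq.1 ho
    have := ihp _ _ h₁ r
    have := ihq _ _ h₂ r
    simp only at *
    omega
  | ite r' p q ihp ihq =>
    intro o ho r
    simp only [run, PMF.mem_support_map_iff] at ho
    obtain ⟨o₁, h₁, rfl⟩ := ho
    have : (o₁.1 r).size ≤ max (s r).size o₁.2 := by
      split_ifs at h₁
      · exact ihp _ _ h₁ r
      · exact ihq _ _ h₁ r
    simp only at *
    omega
  | loop r' p ih =>
    intro o ho r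
    rw [run_loop] at ho
    revert ho
    generalize 1 + Nat.size _ = c
    generalize s r' = n
    intro ho
    induction n generalizing o with
    | zero =>
      rw [iter_zero, PMF.mem_support_pure_iff] at ho
      rw [ho]
      exact le_max_left _ _
    | succ n ihn =>
      simp only [iter_succ, PMF.mem_support_bind_iff, PMF.mem_support_map_iff] at ho
      obtain ⟨o₁, h₁, o₂, h₂, rfl⟩ := ho
      have := ihn _ h₁
      have := ih _ _ h₂ r
      simp only at *
      omega

end Prog

/-! ### Polynomial bounds on the number of steps -/

theorem polynomial_eval_mono (q : Polynomial ℕ) {a b : ℕ} (h : a ≤ b) : q.eval a ≤ q.eval b := by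
  simp only [Polynomial.eval_eq_sum, Polynomial.sum]
  exact Finset.sum_le_sum fun i _ => Nat.mul_le_mul_left _ (Nat.pow_le_pow_left h i)

/-- On the stores described by `I`, the number of steps is polynomially bounded in the security
parameter, the bit width and the sizes of the registers. -/
def Fast (I : ℕ → ℕ → Store → Prop) (p : Prog) : Prop :=
  ∃ q : Polynomial ℕ, ∀ lam ℓ M s, I lam ℓ s → (∀ r, (s r).size ≤ M) →
    ∀ o ∈ (p.run s).support, o.2 ≤ q.eval (lam + ℓ + M)

/-- The second program starts with registers of size at most `M` plus the cost of the first, so the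
two polynomials compose. -/
theorem Fast.seq {I J : ℕ → ℕ → Store → Prop} {p p' : Prog} (hp : Fast I p) (hp' : Fast J p')
    (h : ∀ lam ℓ s, I lam ℓ s → ∀ t ∈ (p.exec s).support, J lam ℓ t) : Fast I (p.seq p') := by
  obtain ⟨q, hq⟩ := hp
  obtain ⟨q', hq'⟩ := hp'
  refine ⟨q + q'.comp (Polynomial.X + q), fun lam ℓ M s hs hM o ho => ?_⟩
  obtain ⟨o₁, h₁, o₂, h₂, rfl⟩ := Prog.mem_support_seq.1 ho
  have hc := hq lam ℓ M s hs hM o₁ h₁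
  rw [Polynomial.eval_add, Polynomial.eval_comp, Polynomial.eval_add, Polynomial.eval_X]
  refine add_le_add hc ?_
  refine (hq' lam ℓ (M + q.eval (lam + ℓ + M)) o₁.1
    (h lam ℓ s hs _ (Prog.mem_support_exec.2 ⟨o₁.2, h₁⟩)) (fun r => ?_) o₂ h₂).trans
    (polynomial_eval_mono _ (by omega))
  have := Prog.size_le _ _ _ h₁ r
  have := hM r
  omega

theorem Fast.mono {I J : ℕ → ℕ → Store → Prop} {p : Prog} (hp : Fast J p)
    (h : ∀ lam ℓ s, I lam ℓ s → J lam ℓ s) : Fast I p := by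
  obtain ⟨q, hq⟩ := hp
  exact ⟨q, fun lam ℓ M s hs => hq lam ℓ M s (h lam ℓ s hs)⟩

theorem Fast.const (I : ℕ → ℕ → Store → Prop) (d c : ℕ) : Fast I (.const d c) := by
  refine ⟨Polynomial.C (1 + c.size), fun lam ℓ M s _ _ o ho => ?_⟩
  simp only [Prog.run, PMF.mem_support_pure_iff] at ho
  simp [ho]

theorem Fast.op (I : ℕ → ℕ → Store → Prop) (o : Op) (d a b : ℕ) : Fast I (.op o d a b) := by
  refine ⟨(1 + Polynomial.X) ^ 2, fun lam ℓ M s _ hM o ho => ?_⟩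
  simp only [Prog.run, PMF.mem_support_pure_iff] at ho
  subst ho
  have ha := hM a
  have hb := hM b
  rw [sq, Polynomial.eval_mul, Polynomial.eval_add, Polynomial.eval_one, Polynomial.eval_X]
  exact Nat.mul_le_mul (by omega) (by omega)

/-- The cost is the value of register `a`, not its size, and would be exponential in general; hence
the requirement that it holds `ℓ`. -/
theorem Fast.rand {I : ℕ → ℕ → Store → Prop} {d a : ℕ} (h : ∀ lam ℓ s, I lam ℓ s → s a = ℓ) :
    Fast I (.rand d a) := by
  refine ⟨1 + Polynomial.X, fun lam ℓ M s hs hM o ho => ?_⟩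
  simp only [Prog.run, PMF.mem_support_map_iff] at ho
  obtain ⟨v, -, rfl⟩ := ho
  simp only [h lam ℓ s hs, Polynomial.eval_add, Polynomial.eval_one, Polynomial.eval_X]
  omega

/-! ### Initial stores: from sizes of registers to lengths of inputs and back. -/

theorem bitLength_le {xs : List ℕ} {M : ℕ} (h : ∀ x ∈ xs, x.size ≤ M) :
    bitLength xs ≤ xs.length * M := by
  rw [bitLength]
  refine (List.sum_le_card_nsmul _ M ?_).trans (by simp)
  simpa using h

theorem size_le_bitLength {xs : List ℕ} {x : ℕ} (h : x ∈ xs) : x.size ≤ bitLength xs :=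
  List.le_sum_of_mem (List.mem_map_of_mem h)

theorem initStore_mem {xs : List ℕ} (r : ℕ) : initStore xs r = 0 ∨ initStore xs r ∈ xs := by
  rw [initStore]
  by_cases h : r < xs.length
  · right
    rw [List.getD_eq_getElem _ _ h]
    exact List.getElem_mem h
  · left
    exact List.getD_eq_default _ _ (by omega)

/-- The stores in which a program with `k` inputs is started. -/
def Initial (k lam ℓ : ℕ) (s : Store) : Prop :=
  ∃ xs : List ℕ, xs.length = k ∧ s = initStore (lam :: ℓ :: xs)

theorem Fast.polyTime {k : ℕ} {p : Prog} (h : Fast (Initial k) p) : PolyTime k p := by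
  obtain ⟨q, hq⟩ := h
  -- All registers have size at most `M = lam + ℓ + bitLength xs`, and `lam + ℓ + M` is at most
  -- twice that.
  refine ⟨q.comp (2 * Polynomial.X), fun lam ℓ xs hxs o ho => ?_⟩
  refine (hq lam ℓ (lam + ℓ + bitLength xs) _ ⟨xs, hxs, rfl⟩ (fun r => ?_) o ho).trans ?_
  · rcases initStore_mem (xs := lam :: ℓ :: xs) r with h | h
    · simp [h]
    · have h₁ : lam.size ≤ lam := Nat.size_le.2 Nat.lt_two_pow_self
      have h₂ : ℓ.size ≤ ℓ := Nat.size_le.2 Nat.lt_two_pow_self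
      rcases List.mem_cons.1 h with h | h
      · rw [h]
        omega
      rcases List.mem_cons.1 h with h | h
      · rw [h]
        omega
      · have := size_le_bitLength h
        omega
  · simp only [Polynomial.eval_comp, Polynomial.eval_mul, Polynomial.eval_ofNat,
      Polynomial.eval_X]
    exact polynomial_eval_mono _ (by omega)

theorem PolyTime.fast_rename {k : ℕ} {p : Prog} (h : PolyTime k p) {φ : ℕ → ℕ}
    (hφ : Function.Injective φ) :
    Fast (fun lam ℓ s => Initial k lam ℓ (s ∘ φ)) (p.rename φ) := by
  obtain ⟨q, hq⟩ := h
  -- The `k` inputs have total length at most `k * M`, and `lam + ℓ + k * M ≤ (k + 1) * (lam + ℓ +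
  -- M)`.
  refine ⟨q.comp (((k + 1 : ℕ) : Polynomial ℕ) * Polynomial.X), fun lam ℓ M s hs hM o ho => ?_⟩
  obtain ⟨xs, hxs, hs⟩ := hs
  rw [Prog.run_rename hφ, PMF.mem_support_map_iff] at ho
  obtain ⟨o', ho', rfl⟩ := ho
  rw [hs] at ho'
  refine (hq lam ℓ xs hxs o' ho').trans ?_
  simp only [Polynomial.eval_comp, Polynomial.eval_mul, Polynomial.eval_natCast,
    Polynomial.eval_X]
  refine polynomial_eval_mono _ ?_
  have : bitLength xs ≤ xs.length * M := by
    refine bitLength_le fun x hx => ?_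
    obtain ⟨i, hi, rfl⟩ := List.getElem_of_mem hx
    have h₁ := congrFun hs (i + 2)
    have h₂ := hM (φ (i + 2))
    simp only [Function.comp_apply, initStore, List.getD_cons_succ,
      List.getD_eq_getElem _ _ hi] at h₁
    rwa [← h₁]
  rw [hxs] at this
  push_cast
  nlinarith

theorem PolyTime.fast {k : ℕ} {p : Prog} (h : PolyTime k p) : Fast (Initial k) p := by
  have := h.fast_rename (φ := id) Function.injective_id
  have hid : ∀ p : Prog, p.rename id = p := by
    intro p
    induction p with
    | seq p q ihp ihq => simp [Prog.rename, ihp, ihq]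
    | ite r p q ihp ihq => simp [Prog.rename, ihp, ihq]
    | loop r p ih => simp [Prog.rename, ih]
    | _ => rfl
  rw [hid] at this
  exact this

/-! ### Subroutine calls -/

theorem initStore_of_length_le {xs : List ℕ} {r : ℕ} (h : xs.length ≤ r) : initStore xs r = 0 :=
  List.getD_eq_default _ _ h

namespace Prog

def copy (d a : ℕ) : Prog := .seq (.const d 0) (.op .add d a d)

theorem exec_copy {d a : ℕ} (h : a ≠ d) (s : Store) :
    (copy d a).exec s = PMF.pure (Function.update s d (s a)) := by
  simp [copy, exec_seq, exec_const, exec_op, Op.eval, Function.update_of_ne h]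

/-- Copies the registers `args` to `base`, `base + 1`, …. -/
def load : (base : ℕ) → (args : List ℕ) → Prog
  | base, [] => .const base 0
  | base, a :: as => .seq (copy base a) (load (base + 1) as)

/-- There is no empty program: the base case writes `0` to a register that `hs` already makes zero.
`fill` and `moveDown` end in the same way. -/
theorem exec_load (base : ℕ) (args : List ℕ) (s : Store) (hargs : ∀ a ∈ args, a < base)
    (hs : ∀ r, base ≤ r → s r = 0) :
    (load base args).exec s =
      PMF.pure fun r => if r < base then s r else initStore (args.map s) (r - base) := by
  induction args generalizing base s with
  | nil =>
    rw [load, exec_const]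
    congr 1
    funext r
    rw [Function.update_apply]
    by_cases h : r < base
    · rw [if_pos h, if_neg (by omega)]
    · rw [if_neg h, hs r (by omega)]
      simp [initStore]
  | cons a as ih =>
    have ha : a < base := hargs a (by simp)
    rw [load, exec_seq, exec_copy ha.ne, PMF.pure_bind, ih]
    · congr 1
      have hmap : as.map (Function.update s base (s a)) = as.map s :=
        List.map_congr_left fun b hb =>
          Function.update_of_ne (hargs b (List.mem_cons_of_mem _ hb)).ne _ _
      funext r
      rw [hmap]
      rcases lt_trichotomy r base with h | h | h
      · rw [if_pos (by omega), if_pos h, Function.update_of_ne h.ne]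
      · subst h
        simp [initStore]
      · rw [if_neg (by omega), if_neg (by omega)]
        obtain ⟨i, rfl⟩ : ∃ i, r = base + 1 + i := ⟨r - (base + 1), by omega⟩
        rw [Nat.add_sub_cancel_left, show base + 1 + i - base = i + 1 by omega]
        simp [initStore]
    · intro b hb
      have := hargs b (List.mem_cons_of_mem _ hb)
      omega
    · intro r hr
      rw [Function.update_of_ne (by omega)]
      exact hs r (by omega)

/-- Sets the registers `base, …, base + c` to zero. -/
def clear (base : ℕ) : ℕ → Prog
  | 0 => .const base 0
  | c + 1 => .seq (clear base c) (.const (base + c + 1) 0)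

theorem exec_clear (base c : ℕ) (s : Store) :
    (clear base c).exec s = PMF.pure fun r => if base ≤ r ∧ r ≤ base + c then 0 else s r := by
  induction c with
  | zero =>
    rw [clear, exec_const]
    congr 1
    funext r
    rw [Function.update_apply]
    congr 1
    exact propext ⟨by omega, by omega⟩
  | succ c ih =>
    rw [clear, exec_seq, ih, PMF.pure_bind, exec_const]
    congr 1
    funext r
    rw [Function.update_apply]
    split_ifs <;> first | rfl | omega

/-- Runs `p` on the arguments in the registers `args`, with working registers from `N` on, of which
`N, …, N + c` are cleared afterwards. -/
def call (N c : ℕ) (p : Prog) (args : List ℕ) (out : ℕ) : Prog :=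
  .seq (load N args) (.seq (p.rename (N + ·)) (.seq (copy out N) (clear N c)))

/-- Shifted by `N`, the subroutine sees exactly its initial store. By `hc` it leaves everything from
`N + c` on at zero, so clearing the block below restores the zeros, and the only lasting effect is
on `out`. -/
theorem exec_call {N c : ℕ} {p : Prog} {args : List ℕ} {out : ℕ} {s : Store}
    (hargs : ∀ a ∈ args, a < N) (hlen : args.length ≤ c)
    (hc : ∀ s, ∀ o ∈ (p.run s).support, ∀ r, c ≤ r → o.1 r = s r)
    (hout : out < N) (hs : ∀ r, N ≤ r → s r = 0) :
    (call N c p args out).exec s =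
      (p.exec (initStore (args.map s))).map fun t => Function.update s out (t 0) := by
  rw [call, exec_seq, exec_load N args s hargs hs, PMF.pure_bind, exec_seq]
  set s₁ : Store := fun r => if r < N then s r else initStore (args.map s) (r - N) with hs₁
  have hcomp : s₁ ∘ (N + ·) = initStore (args.map s) := by
    funext r
    simp [hs₁]
  have hren : (p.rename (N + ·)).exec s₁ =
      (p.exec (initStore (args.map s))).map fun t => Function.extend (N + ·) t s₁ := by
    rw [exec, run_rename (add_right_injective N), hcomp, exec, PMF.map_comp, PMF.map_comp]
    rfl
  rw [hren, PMF.bind_map]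
  rw [← PMF.bind_pure_comp]
  refine bind_congr_support fun t ht => ?_
  obtain ⟨k, ht⟩ := mem_support_exec.1 ht
  simp only [Function.comp_apply]
  rw [exec_seq, exec_copy (by omega), PMF.pure_bind, exec_clear]
  congr 1
  have h0 : Function.extend (N + ·) t s₁ N = t 0 :=
    (add_right_injective N).extend_apply t s₁ 0
  funext r
  rw [h0]
  by_cases hr : r < N
  · rw [if_neg (by omega), Function.update_apply, Function.update_apply]
    split_ifs with h
    · rfl
    · rw [Function.extend_apply' _ _ _ (by rintro ⟨a, rfl⟩; omega)]
      simp only [hs₁]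
      rw [if_pos hr]
  · have h1 : Function.update s out (t 0) r = 0 := by
      rw [Function.update_of_ne (by omega), hs r (by omega)]
    rw [h1]
    split_ifs with h
    · rfl
    · rw [Function.update_of_ne (show r ≠ out by omega)]
      obtain ⟨i, rfl⟩ : ∃ i, r = N + i := ⟨r - N, by omega⟩
      refine ((add_right_injective N).extend_apply t s₁ i).trans ?_
      exact (hc _ _ ht i (by omega)).trans (initStore_of_length_le (by simp; omega))

end Prog

open Prog

theorem Fast.copy (I : ℕ → ℕ → Store → Prop) (d a : ℕ) : Fast I (copy d a) :=
  (Fast.const I d 0).seq (Fast.op (fun _ _ _ => True) _ _ _ _) fun _ _ _ _ _ _ => trivial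

theorem Fast.load (I : ℕ → ℕ → Store → Prop) (base : ℕ) (args : List ℕ) :
    Fast I (load base args) := by
  induction args generalizing base I with
  | nil => exact Fast.const I _ _
  | cons a as ih => exact (Fast.copy I _ _).seq (ih (fun _ _ _ => True) _) fun _ _ _ _ _ _ => trivial

theorem Fast.clear (I : ℕ → ℕ → Store → Prop) (base c : ℕ) : Fast I (clear base c) := by
  induction c with
  | zero => exact Fast.const I _ _
  | succ c ih =>
    exact ih.seq (Fast.const (fun _ _ _ => True) _ _) fun _ _ _ _ _ _ => trivial

/-- The security parameter and the bit width are in the registers `A` and `B`, and the registers from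
`N` on are zero. -/
def Inv (A B N lam ℓ : ℕ) (s : Store) : Prop := s A = lam ∧ s B = ℓ ∧ ∀ r, N ≤ r → s r = 0

theorem Inv.update {A B N lam ℓ : ℕ} {s : Store} (h : Inv A B N lam ℓ s) {d : ℕ} (hA : d ≠ A)
    (hB : d ≠ B) (hN : d < N) (v : ℕ) : Inv A B N lam ℓ (Function.update s d v) := by
  refine ⟨?_, ?_, fun r hr => ?_⟩
  · rw [Function.update_of_ne hA.symm]
    exact h.1
  · rw [Function.update_of_ne hB.symm]
    exact h.2.1
  · rw [Function.update_of_ne (by omega)]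
    exact h.2.2 r hr

theorem Fast.call {A B N k c : ℕ} {p : Prog} {args : List ℕ} {out : ℕ} (hp : PolyTime k p)
    (hargs : ∀ a ∈ A :: B :: args, a < N) (hlen : args.length = k) :
    Fast (Inv A B N) (call N c p (A :: B :: args) out) := by
  refine (Fast.load _ N _).seq ((hp.fast_rename (add_right_injective N)).seq
    ((Fast.copy (fun _ _ _ => True) _ _).seq (Fast.clear (fun _ _ _ => True) _ _)
      fun _ _ _ _ _ _ => trivial) fun _ _ _ _ _ _ => trivial) ?_
  intro lam ℓ s hs t ht
  rw [exec_load N _ s hargs hs.2.2, PMF.mem_support_pure_iff] at ht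
  refine ⟨args.map s, by simpa using hlen, ?_⟩
  subst ht
  funext r
  simp [hs.1, hs.2.1]

/-- There is a program that stores a sample of the output of `p` in the register `out`. -/
theorem exists_call {A B N k : ℕ} {p : Prog} {args : List ℕ} (hp : PolyTime k p)
    (hargs : ∀ a ∈ A :: B :: args, a < N) (hlen : args.length = k) :
    ∃ cl : ℕ → Prog, ∀ out < N, Fast (Inv A B N) (cl out) ∧
      ∀ lam ℓ s, Inv A B N lam ℓ s → (cl out).exec s =
        (p.exec (initStore (lam :: ℓ :: args.map s))).map fun t => Function.update s out (t 0) := by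
  obtain ⟨B', hB'⟩ := exists_frame p
  -- The cleared block must cover both the registers the subroutine can write and its `k + 2`
  -- arguments.
  refine ⟨Prog.call N (max B' (k + 2)) p (A :: B :: args), fun out hout =>
    ⟨Fast.call hp hargs hlen, fun lam ℓ s hs => ?_⟩⟩
  rw [exec_call hargs (by simp [hlen]) (fun s o ho r hr => hB' s o ho r (by omega)) hout hs.2.2]
  simp [hs.1, hs.2.1]

/-! ### Independent samples in consecutive registers -/

namespace Prog

/-- Runs `p base, …, p (base + t - 1)`; the register `Z` is supposed to be zero. -/
def fill (Z : ℕ) (p : ℕ → Prog) : (base t : ℕ) → Prog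
  | _, 0 => .const Z 0
  | base, t + 1 => .seq (p base) (fill Z p (base + 1) t)

/-- The store `s` with the numbers `f` written to the registers from `base` on. -/
def overwrite (s : Store) (base : ℕ) {t : ℕ} (f : Fin t → ℕ) : Store := fun r =>
  if h : base ≤ r ∧ r < base + t then f ⟨r - base, by omega⟩ else s r

theorem overwrite_add (s : Store) (base : ℕ) {t : ℕ} (f : Fin t → ℕ) (i : Fin t) :
    overwrite s base f (base + i) = f i := by
  rw [overwrite, dif_pos ⟨by omega, by omega⟩]
  congr 1
  ext
  simp

theorem overwrite_of_lt (s : Store) (base : ℕ) {t : ℕ} (f : Fin t → ℕ) {r : ℕ} (h : r < base) :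
    overwrite s base f r = s r := dif_neg (by omega)

theorem overwrite_of_ge (s : Store) (base : ℕ) {t : ℕ} (f : Fin t → ℕ) {r : ℕ}
    (h : base + t ≤ r) : overwrite s base f r = s r := dif_neg (by omega)

theorem overwrite_zero (s : Store) (base : ℕ) (f : Fin 0 → ℕ) : overwrite s base f = s := by
  funext r
  exact dif_neg (by omega)

theorem overwrite_update_cons (s : Store) (base v : ℕ) {t : ℕ} (f : Fin t → ℕ) :
    overwrite (Function.update s base v) (base + 1) f =
      overwrite s base (Fin.cons v f : Fin (t + 1) → ℕ) := by
  funext r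
  rcases lt_trichotomy r base with h | h | h
  · rw [overwrite_of_lt _ _ _ (by omega), overwrite_of_lt _ _ _ h, Function.update_of_ne h.ne]
  · subst h
    rw [overwrite_of_lt _ _ _ (by omega), Function.update_self]
    exact (overwrite_add s r (Fin.cons v f : Fin (t + 1) → ℕ) 0).symm
  · by_cases h' : r < base + 1 + t
    · obtain ⟨i, rfl⟩ : ∃ i : Fin t, r = base + 1 + i := ⟨⟨r - (base + 1), by omega⟩, by simp; omega⟩
      rw [overwrite_add]
      have := overwrite_add s base (Fin.cons v f : Fin (t + 1) → ℕ) i.succ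
      rw [Fin.cons_succ] at this
      rw [← this]
      congr 1
      simp
      omega
    · rw [overwrite_of_ge _ _ _ (by omega), overwrite_of_ge _ _ _ (by omega),
        Function.update_of_ne h.ne']

end Prog

/-- `p d` stores a sample of `μ` in the register `d`. -/
def Samples (I : Store → Prop) (p : Prog) (d : ℕ) (μ : PMF ℕ) : Prop :=
  ∀ s, I s → p.exec s = μ.map fun v => Function.update s d v

theorem Inv.overwrite {A B N lam ℓ : ℕ} {s : Store} (h : Inv A B N lam ℓ s) {base t : ℕ}
    (hA : A < base ∨ base + t ≤ A) (hB : B < base ∨ base + t ≤ B) (hN : base + t ≤ N)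
    (f : Fin t → ℕ) : Inv A B N lam ℓ (overwrite s base f) := by
  have key : ∀ r, r < base ∨ base + t ≤ r → Prog.overwrite s base f r = s r := by
    rintro r (hr | hr)
    · exact overwrite_of_lt _ _ _ hr
    · exact overwrite_of_ge _ _ _ hr
  refine ⟨?_, ?_, fun r hr => ?_⟩
  · rw [key A hA]
    exact h.1
  · rw [key B hB]
    exact h.2.1
  · rw [key r (Or.inr (by omega))]
    exact h.2.2 r hr

theorem exec_fill {A B N lam ℓ Z : ℕ} {p : ℕ → Prog} {μ : PMF ℕ} (hZ : N ≤ Z) (t base : ℕ)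
    (hA : A < base ∨ base + t ≤ A) (hB : B < base ∨ base + t ≤ B) (hN : base + t ≤ N)
    (hp : ∀ d, base ≤ d → d < base + t → Samples (Inv A B N lam ℓ) (p d) d μ) :
    ∀ s, Inv A B N lam ℓ s → (fill Z p base t).exec s = (iid μ t).map (overwrite s base) := by
  induction t generalizing base with
  | zero =>
    intro s hs
    rw [fill, exec_const, iid, PMF.pure_map, overwrite_zero]
    congr 1
    rw [Function.update_eq_self_iff, hs.2.2 Z hZ]
  | succ t ih =>
    intro s hs
    rw [fill, exec_seq, hp base le_rfl (by omega) s hs, PMF.bind_map, iid, PMF.map_bind]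
    congr 1
    funext v
    simp only [Function.comp_apply, PMF.map_comp]
    rw [ih (base + 1) (by omega) (by omega) (by omega)
      (fun d h₁ h₂ => hp d (by omega) (by omega)) _
      (hs.update (by omega) (by omega) (by omega) v)]
    congr 1
    funext f
    exact overwrite_update_cons s base v f

theorem Fast.fill {A B N Z : ℕ} {p : ℕ → Prog} (t base : ℕ)
    (hA : A < base ∨ base + t ≤ A) (hB : B < base ∨ base + t ≤ B) (hN : base + t ≤ N)
    (hp : ∀ d, base ≤ d → d < base + t → Fast (Inv A B N) (p d) ∧
      ∀ lam ℓ s, Inv A B N lam ℓ s → ∀ s' ∈ ((p d).exec s).support, ∃ v, s' = Function.update s d v) :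
    Fast (Inv A B N) (fill Z p base t) := by
  induction t generalizing base with
  | zero => exact Fast.const _ _ _
  | succ t ih =>
    have h := hp base le_rfl (by omega)
    refine h.1.seq (ih (base + 1) (by omega) (by omega) (by omega)
      fun d h₁ h₂ => hp d (by omega) (by omega)) fun lam ℓ s hs s' hs' => ?_
    obtain ⟨v, rfl⟩ := h.2 lam ℓ s hs s' hs'
    exact hs.update (by omega) (by omega) (by omega) v

theorem list_map_range_add (s : Store) (a b : ℕ) :
    (List.range (a + b)).map s = (List.range a).map s ++ (List.range b).map fun i => s (a + i) := by
  rw [List.range_add, List.map_append, List.map_map]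
  rfl

theorem list_map_range_eq_ofFn {s : Store} {a t : ℕ} {f : Fin t → ℕ} (h : ∀ i : Fin t, s (a + i) = f i) :
    ((List.range t).map fun i => s (a + i)) = List.ofFn f := by
  refine List.ext_getElem (by simp) fun i h₁ h₂ => ?_
  simp only [List.getElem_map, List.getElem_range, List.getElem_ofFn]
  exact h ⟨i, by simpa using h₂⟩

/-! ### The simulator -/

namespace Prog

/-- Moves the registers `2, …, k + 1` to `0, …, k - 1`; the register `Z` is supposed to be zero. -/
def moveDown (Z : ℕ) : ℕ → Prog
  | 0 => .const Z 0
  | k + 1 => .seq (moveDown Z k) (copy k (k + 2))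

/-- Copying upwards in order reads each source `k + 2` before anything is written to it. -/
theorem exec_moveDown {Z : ℕ} {s : Store} (hZ : s Z = 0) (k : ℕ) :
    (moveDown Z k).exec s = PMF.pure fun r => if r < k then s (r + 2) else s r := by
  induction k with
  | zero =>
    rw [moveDown, exec_const]
    congr 1
    simp [Function.update_eq_self_iff, hZ]
  | succ k ih =>
    rw [moveDown, exec_seq, ih, PMF.pure_bind, exec_copy (by omega)]
    congr 1
    funext r
    rw [Function.update_apply]
    rcases lt_trichotomy r k with h | h | h
    · rw [if_neg h.ne, if_pos h, if_pos (by omega)]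
    · rw [if_pos h, if_neg (by omega), if_pos (by omega), h]
    · rw [if_neg h.ne', if_neg (by omega), if_neg (by omega)]

end Prog

theorem Fast.moveDown (I : ℕ → ℕ → Store → Prop) (Z k : ℕ) : Fast I (moveDown Z k) := by
  induction k with
  | zero => exact Fast.const I _ _
  | succ k ih => exact ih.seq (Fast.copy (fun _ _ _ => True) _ _) fun _ _ _ _ _ _ => trivial

/-- A uniform number with `ℓ` bits. -/
noncomputable def uniformBits (ℓ : ℕ) : PMF ℕ :=
  (PMF.uniformOfFintype (Fin (2 ^ ℓ))).map Fin.val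

/-- The content of the first register after the execution. -/
noncomputable def Prog.result (p : Prog) (input : List ℕ) : PMF ℕ :=
  (p.exec (initStore input)).map fun s => s 0

theorem output_one (p : Prog) (input : List ℕ) :
    p.output 1 input = (p.result input).map fun v => [v] := by
  rw [output_eq, Prog.result, PMF.map_comp]
  rfl

/-- Output is read from the first registers, so the input shares move to the front and the public
parameters are parked just behind the space for the view. -/
theorem exists_setup {k vl : ℕ} (hvl : k + 2 ≤ vl) :
    ∃ p : Prog, Fast (Initial k) p ∧ ∀ lam ℓ (xs : List ℕ), xs.length = k →
      ∃ s : Store, p.exec (initStore (lam :: ℓ :: xs)) = PMF.pure s ∧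
        Inv vl (vl + 1) (vl + 2) lam ℓ s ∧ (List.range k).map s = xs := by
  refine ⟨.seq (copy vl 0) (.seq (copy (vl + 1) 1) (moveDown (vl + 2) k)), ?_, ?_⟩
  · exact (Fast.copy _ _ _).seq ((Fast.copy (fun _ _ _ => True) _ _).seq
      (Fast.moveDown (fun _ _ _ => True) _ _) fun _ _ _ _ _ _ => trivial)
      fun _ _ _ _ _ _ => trivial
  · intro lam ℓ xs hxs
    have hlen : (lam :: ℓ :: xs).length = k + 2 := by simp [hxs]
    have hzero : ∀ r, k + 2 ≤ r → initStore (lam :: ℓ :: xs) r = 0 := fun r hr =>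
      initStore_of_length_le (by omega)
    refine ⟨fun r => if r < k then initStore (lam :: ℓ :: xs) (r + 2) else
        Function.update (Function.update (initStore (lam :: ℓ :: xs)) vl lam) (vl + 1) ℓ r,
        ?_, ?_, ?_⟩
    · rw [exec_seq, exec_copy (by omega), PMF.pure_bind, exec_seq, exec_copy (by omega),
        PMF.pure_bind, exec_moveDown]
      · congr 1
        funext r
        have h0 : initStore (lam :: ℓ :: xs) 0 = lam := rfl
        have h1 : Function.update (initStore (lam :: ℓ :: xs)) vl lam 1 = ℓ := by
          rw [Function.update_of_ne (by omega)]
          rfl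
        rw [h0, h1]
        split_ifs with h
        · rw [Function.update_of_ne (by omega), Function.update_of_ne (by omega)]
        · rfl
      · rw [Function.update_of_ne (by omega), Function.update_of_ne (by omega)]
        exact hzero _ (by omega)
    · refine ⟨?_, ?_, fun r hr => ?_⟩
      · beta_reduce
        rw [if_neg (by omega), Function.update_of_ne (by omega), Function.update_self]
      · beta_reduce
        rw [if_neg (by omega), Function.update_self]
      · beta_reduce
        rw [if_neg (by omega), Function.update_of_ne (by omega), Function.update_of_ne (by omega)]
        exact hzero _ (by omega)
    · refine List.ext_getElem (by simp [hxs]) fun i h₁ h₂ => ?_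
      rw [List.getElem_map, List.getElem_range, if_pos (by omega)]
      simp [initStore, h₂]

theorem exists_simulator {Sim : Prog} (hSim : PolyTime 0 Sim) (n k : ℕ) :
    ∃ S : Prog, PolyTime k S ∧ ∀ lam ℓ (xs : List ℕ), xs.length = k →
      S.output (viewLength n k) (lam :: ℓ :: xs) =
        (iid (uniformBits ℓ) (n + 1)).bind fun a =>
          (iid (Sim.result [lam, ℓ]) (n + 1)).bind fun κ =>
            (iid (uniformBits ℓ) n).map fun ρ =>
              xs ++ List.ofFn a ++ List.ofFn κ ++ List.ofFn ρ := by
  obtain ⟨vl, hvl⟩ : ∃ vl, vl = viewLength n k := ⟨_, rfl⟩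
  have hvl' : vl = k + (n + 1) + (n + 1) + n := hvl
  obtain ⟨setup, hfast, hsetup⟩ := exists_setup (show k + 2 ≤ vl by omega)
  obtain ⟨cl, hcl⟩ := exists_call (A := vl) (B := vl + 1) (N := vl + 2) (args := []) hSim
    (by simp) rfl
  have hrand : ∀ lam ℓ d, d < vl →
      Samples (Inv vl (vl + 1) (vl + 2) lam ℓ) (.rand d (vl + 1)) d (uniformBits ℓ) := by
    intro lam ℓ d _ s hs
    rw [exec_rand, hs.2.1, uniformBits, PMF.map_comp]
    rfl
  have hcall : ∀ lam ℓ d, d < vl →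
      Samples (Inv vl (vl + 1) (vl + 2) lam ℓ) (cl d) d (Sim.result [lam, ℓ]) := by
    intro lam ℓ d hd s hs
    rw [(hcl d (by omega)).2 lam ℓ s hs, Prog.result, PMF.map_comp]
    rfl
  have supp : ∀ {lam ℓ d μ p s s'}, Samples (Inv vl (vl + 1) (vl + 2) lam ℓ) p d μ →
      Inv vl (vl + 1) (vl + 2) lam ℓ s → s' ∈ (p.exec s).support →
      ∃ v, s' = Function.update s d v := by
    intro lam ℓ d μ p s s' hp hs hs'
    rw [hp s hs, PMF.mem_support_map_iff] at hs'
    obtain ⟨v, -, rfl⟩ := hs'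
    exact ⟨v, rfl⟩
  -- The blocks follow the order of `View.toList`: shares of the masks, keys, received messages.
  -- They also overwrite leftovers of the input above register `k`.
  let F1 := fill (vl + 2) (fun d => .rand d (vl + 1)) k (n + 1)
  let F2 := fill (vl + 2) cl (k + (n + 1)) (n + 1)
  let F3 := fill (vl + 2) (fun d => .rand d (vl + 1)) (k + (n + 1) + (n + 1)) n
  have h1 : ∀ lam ℓ s, Inv vl (vl + 1) (vl + 2) lam ℓ s →
      F1.exec s = (iid (uniformBits ℓ) (n + 1)).map (overwrite s k) := fun lam ℓ =>
    exec_fill le_rfl _ _ (by omega) (by omega) (by omega) fun d _ _ => hrand lam ℓ d (by omega)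
  have h2 : ∀ lam ℓ s, Inv vl (vl + 1) (vl + 2) lam ℓ s →
      F2.exec s = (iid (Sim.result [lam, ℓ]) (n + 1)).map (overwrite s (k + (n + 1))) :=
    fun lam ℓ => exec_fill le_rfl _ _ (by omega) (by omega) (by omega)
      fun d _ _ => hcall lam ℓ d (by omega)
  have h3 : ∀ lam ℓ s, Inv vl (vl + 1) (vl + 2) lam ℓ s →
      F3.exec s = (iid (uniformBits ℓ) n).map (overwrite s (k + (n + 1) + (n + 1))) :=
    fun lam ℓ => exec_fill le_rfl _ _ (by omega) (by omega) (by omega)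
      fun d _ _ => hrand lam ℓ d (by omega)
  have f1 : Fast (Inv vl (vl + 1) (vl + 2)) F1 :=
    Fast.fill _ _ (by omega) (by omega) (by omega) fun d _ _ =>
      ⟨Fast.rand fun _ _ _ hs => hs.2.1, fun lam ℓ _ hs _ => supp (hrand lam ℓ d (by omega)) hs⟩
  have f2 : Fast (Inv vl (vl + 1) (vl + 2)) F2 :=
    Fast.fill _ _ (by omega) (by omega) (by omega) fun d _ _ =>
      ⟨(hcl d (by omega)).1, fun lam ℓ _ hs _ => supp (hcall lam ℓ d (by omega)) hs⟩
  have f3 : Fast (Inv vl (vl + 1) (vl + 2)) F3 :=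
    Fast.fill _ _ (by omega) (by omega) (by omega) fun d _ _ =>
      ⟨Fast.rand fun _ _ _ hs => hs.2.1, fun lam ℓ _ hs _ => supp (hrand lam ℓ d (by omega)) hs⟩
  refine ⟨.seq setup (.seq F1 (.seq F2 F3)), Fast.polyTime ?_, ?_⟩
  · refine hfast.seq (f1.seq (f2.seq f3 ?_) ?_) ?_
    · intro lam ℓ s hs t ht
      rw [h2 lam ℓ s hs, PMF.mem_support_map_iff] at ht
      obtain ⟨g, -, rfl⟩ := ht
      exact hs.overwrite (by omega) (by omega) (by omega) g
    · intro lam ℓ s hs t ht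
      rw [h1 lam ℓ s hs, PMF.mem_support_map_iff] at ht
      obtain ⟨g, -, rfl⟩ := ht
      exact hs.overwrite (by omega) (by omega) (by omega) g
    · rintro lam ℓ s ⟨xs, hxs, rfl⟩ t ht
      obtain ⟨s, hs, hinv, -⟩ := hsetup lam ℓ xs hxs
      rw [hs, PMF.mem_support_pure_iff] at ht
      rwa [ht]
  · intro lam ℓ xs hxs
    obtain ⟨s, hs, hinv, hlist⟩ := hsetup lam ℓ xs hxs
    rw [output_eq, exec_seq, hs, PMF.pure_bind, exec_seq, h1 lam ℓ s hinv, PMF.bind_map,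
      PMF.map_bind]
    congr 1
    funext a
    have ha : Inv vl (vl + 1) (vl + 2) lam ℓ (overwrite s k a) :=
      hinv.overwrite (by omega) (by omega) (by omega) a
    simp only [Function.comp_apply]
    rw [exec_seq, h2 lam ℓ _ ha, PMF.bind_map, PMF.map_bind]
    congr 1
    funext κ
    have hκ := ha.overwrite (base := k + (n + 1)) (t := n + 1) (by omega) (by omega) (by omega) κ
    simp only [Function.comp_apply]
    rw [h3 lam ℓ _ hκ, PMF.map_comp]
    congr 1
    funext ρ
    simp only [Function.comp_apply, viewLength]
    rw [list_map_range_add, list_map_range_add, list_map_range_add]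
    congr 1
    · congr 1
      · congr 1
        · rw [← hlist]
          refine List.map_congr_left fun r hr => ?_
          have := List.mem_range.1 hr
          rw [overwrite_of_lt _ _ _ (by omega), overwrite_of_lt _ _ _ (by omega),
            overwrite_of_lt _ _ _ (by omega)]
        · refine list_map_range_eq_ofFn fun i => ?_
          rw [overwrite_of_lt _ _ _ (by omega), overwrite_of_lt _ _ _ (by omega), overwrite_add]
      · refine list_map_range_eq_ofFn fun i => ?_
        rw [overwrite_of_lt _ _ _ (by omega), overwrite_add]
    · exact list_map_range_eq_ofFn fun i => overwrite_add _ _ _ i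

/-! ### The reduction to the security of the comparison keys -/

/-- Reading the inputs back from the registers makes a `PolyTime` bound applicable in the middle of
a computation. -/
theorem Inv.initial {k lam ℓ : ℕ} {s : Store} (h : Inv 0 1 (k + 2) lam ℓ s) :
    Initial k lam ℓ s := by
  refine ⟨List.ofFn fun i : Fin k => s (i + 2), by simp, ?_⟩
  funext r
  match r with
  | 0 => exact h.1
  | 1 => exact h.2.1
  | r + 2 =>
    simp only [initStore, List.getD_cons_succ]
    by_cases hr : r < k
    · rw [List.getD_eq_getElem _ _ (by simpa using hr)]
      simp
    · rw [List.getD_eq_default _ _ (by simpa using hr)]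
      exact h.2.2 _ (by omega)

theorem Initial.inv {k N lam ℓ : ℕ} {s : Store} (h : Initial k lam ℓ s) (hN : k + 2 ≤ N) :
    Inv 0 1 N lam ℓ s := by
  obtain ⟨xs, hxs, rfl⟩ := h
  exact ⟨rfl, rfl, fun r hr => initStore_of_length_le (by simp [hxs]; omega)⟩

/-- Fast programs that keep the public parameters and the zeros from the register `N` on. -/
def Keeps (N : ℕ) (p : Prog) : Prop :=
  Fast (Inv 0 1 N) p ∧ ∀ lam ℓ s, Inv 0 1 N lam ℓ s → ∀ t ∈ (p.exec s).support, Inv 0 1 N lam ℓ t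

theorem Keeps.seq {N : ℕ} {p q : Prog} (hp : Keeps N p) (hq : Keeps N q) :
    Keeps N (p.seq q) := by
  refine ⟨hp.1.seq hq.1 hp.2, fun lam ℓ s hs t ht => ?_⟩
  rw [exec_seq, PMF.mem_support_bind_iff] at ht
  obtain ⟨s', hs', ht⟩ := ht
  exact hq.2 lam ℓ s' (hp.2 lam ℓ s hs s' hs') t ht

theorem Keeps.op {N d : ℕ} (o : Op) (a b : ℕ) (h₂ : 2 ≤ d) (hd : d < N) :
    Keeps N (.op o d a b) := by
  refine ⟨Fast.op _ _ _ _ _, fun lam ℓ s hs t ht => ?_⟩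
  rw [exec_op, PMF.mem_support_pure_iff] at ht
  subst ht
  exact hs.update (by omega) (by omega) hd _

theorem Keeps.copy {N d a : ℕ} (h₂ : 2 ≤ d) (hd : d < N) : Keeps N (copy d a) := by
  refine Keeps.seq ⟨Fast.const _ _ _, fun lam ℓ s hs t ht => ?_⟩ (Keeps.op _ _ _ h₂ hd)
  rw [exec_const, PMF.mem_support_pure_iff] at ht
  subst ht
  exact hs.update (by omega) (by omega) hd _

/-- `d := (e * c + a) % q` -/
def Prog.affine (d e c a q : ℕ) : Prog := .seq (.op .mul d e c) (.seq (.op .add d d a) (.op .mod d d q))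

theorem Prog.exec_affine {d e c a q : ℕ} (ha : a ≠ d) (hq : q ≠ d) (s : Store) :
    (affine d e c a q).exec s = PMF.pure (Function.update s d ((s e * s c + s a) % s q)) := by
  simp [affine, exec_seq, exec_op, Op.eval, Function.update_of_ne ha, Function.update_of_ne hq]

theorem Keeps.affine {N d : ℕ} (e c a q : ℕ) (h₂ : 2 ≤ d) (hd : d < N) :
    Keeps N (affine d e c a q) :=
  (Keeps.op _ _ _ h₂ hd).seq ((Keeps.op _ _ _ h₂ hd).seq (Keeps.op _ _ _ h₂ hd))

theorem result_of_output_one {p : Prog} {input : List ℕ} {v : ℕ}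
    (h : p.output 1 input = PMF.pure [v]) : p.result input = PMF.pure v := by
  have := congrArg (PMF.map fun l : List ℕ => l.getD 0 0) h
  rw [output_one, PMF.map_comp, PMF.pure_map] at this
  exact (PMF.map_id _).symm.trans this

/-- The advice carries a list with a gap at `slot`, two placeholders for the output shares, the
party, the modulus, the evaluation point and two affine maps. The challenge key fills the gap and is
evaluated once, which yields both output shares. -/
theorem exists_reduction (Φ : DCF) {D : Prog} {k : ℕ} (hD : PolyTime (k + 2) D) {slot : ℕ}
    (hslot : slot < k) :
    ∃ R : Prog, PolyTime (k + 9 + 1) R ∧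
      ∀ (lam ℓ : ℕ) (xs : List ℕ) (b : Fin 2) (Q m A₀ C₀ A₁ C₁ κ : ℕ), xs.length = k →
        R.output 1 (lam :: ℓ :: ((xs ++ [0, 0, b.val, Q, m, A₀, C₀, A₁, C₁]) ++ [κ])) =
          D.output 1 (lam :: ℓ :: (xs.set slot κ ++
            [(Φ.share lam ℓ b κ m * C₀ + A₀) % Q, (Φ.share lam ℓ b κ m * C₁ + A₁) % Q])) := by
  obtain ⟨p, hp⟩ : ∃ p, p = k + 2 := ⟨_, rfl⟩
  obtain ⟨cl, hcl⟩ := exists_call (A := 0) (B := 1) (N := p + 11)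
    (args := [p + 2, p + 9, p + 4]) Φ.eval_polyTime
    (by simp only [List.mem_cons, List.not_mem_nil, or_false]; omega) rfl
  obtain ⟨hfast, hexec⟩ := hcl (p + 10) (by omega)
  have hcall : Keeps (p + 11) (cl (p + 10)) := by
    refine ⟨hfast, fun lam ℓ s hs t ht => ?_⟩
    rw [hexec lam ℓ s hs, PMF.mem_support_map_iff] at ht
    obtain ⟨s', -, rfl⟩ := ht
    exact hs.update (by omega) (by omega) (by omega) _
  -- Here `p` and `p + 1` are the placeholders, `p + 9` holds the challenge and `p + 10` its
  -- evaluation. Clearing `p + 2, …, p + 10` leaves precisely an initial store for `D`.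
  refine ⟨.seq (.seq (cl (p + 10)) (.seq (copy (2 + slot) (p + 9))
    (.seq (affine p (p + 10) (p + 6) (p + 5) (p + 3))
    (affine (p + 1) (p + 10) (p + 8) (p + 7) (p + 3))))) (.seq (clear (p + 2) 8) D),
    Fast.polyTime ?_, ?_⟩
  · have hkeep := hcall.seq ((Keeps.copy (N := p + 11) (d := 2 + slot) (a := p + 9)
      (by omega) (by omega)).seq
      ((Keeps.affine (N := p + 11) (p + 10) (p + 6) (p + 5) (p + 3) (show 2 ≤ p by omega)
        (by omega)).seq
      (Keeps.affine (N := p + 11) (p + 10) (p + 8) (p + 7) (p + 3) (show 2 ≤ p + 1 by omega)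
        (by omega))))
    refine (hkeep.1.seq ((Fast.clear (Inv 0 1 (p + 11)) _ _).seq hD.fast ?_) hkeep.2).mono
      fun lam ℓ s hs => hs.inv (by omega)
    intro lam ℓ s hs t ht
    rw [exec_clear, PMF.mem_support_pure_iff] at ht
    have htr := congrFun ht
    refine Inv.initial ⟨?_, ?_, fun r hr => ?_⟩
    · rw [htr, if_neg (by omega), hs.1]
    · rw [htr, if_neg (by omega), hs.2.1]
    · rw [htr]
      split_ifs with h
      · rfl
      · exact hs.2.2 r (by omega)
  · intro lam ℓ xs b Q m A₀ C₀ A₁ C₁ κ hxs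
    rw [output_eq, output_eq]
    congr 1
    set s := initStore (lam :: ℓ :: ((xs ++ [0, 0, b.val, Q, m, A₀, C₀, A₁, C₁]) ++ [κ])) with hs
    have hinv : Inv 0 1 (p + 11) lam ℓ s :=
      Initial.inv ⟨_, rfl, rfl⟩ (by simp [hxs]; omega)
    have hlow : ∀ i < k, s (2 + i) = xs.getD i 0 := by
      intro i hi
      rw [hs, add_comm, initStore, List.getD_cons_succ, List.getD_cons_succ, List.append_assoc,
        List.getD_append _ _ _ _ (by omega)]
    have hhigh : ∀ i, s (p + i) = [0, 0, b.val, Q, m, A₀, C₀, A₁, C₁, κ].getD i 0 := by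
      intro i
      rw [hs, hp, show k + 2 + i = (k + i) + 1 + 1 by omega, initStore, List.getD_cons_succ,
        List.getD_cons_succ, List.append_assoc, List.getD_append_right _ _ _ _ (by omega), hxs,
        Nat.add_sub_cancel_left]
      rfl
    have h2 : s (p + 2) = b.val := hhigh 2
    have h3 : s (p + 3) = Q := hhigh 3
    have h4 : s (p + 4) = m := hhigh 4
    have h5 : s (p + 5) = A₀ := hhigh 5
    have h6 : s (p + 6) = C₀ := hhigh 6
    have h7 : s (p + 7) = A₁ := hhigh 7
    have h8 : s (p + 8) = C₁ := hhigh 8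
    have h9 : s (p + 9) = κ := hhigh 9
    have heval := result_of_output_one (Φ.eval_output lam ℓ b κ m)
    set e := Φ.share lam ℓ b κ m with he
    have hc : (cl (p + 10)).exec s = PMF.pure (Function.update s (p + 10) e) := by
      rw [hexec lam ℓ s hinv]
      simp only [List.map_cons, List.map_nil, h2, h9, h4]
      have := congrArg (PMF.map fun v => Function.update s (p + 10) v) heval
      rwa [result, PMF.map_comp, PMF.pure_map] at this
    set v₀ := (e * C₀ + A₀) % Q with hv₀
    set v₁ := (e * C₁ + A₁) % Q with hv₁
    set s₁ := Function.update s (p + 10) e with hs₁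
    have s₁_of : ∀ r, r ≠ p + 10 → s₁ r = s r := fun r hr => Function.update_of_ne hr _ _
    set s₂ := Function.update s₁ (2 + slot) κ with hs₂
    have s₂_of : ∀ r, p ≤ r → s₂ r = s₁ r := fun r hr => Function.update_of_ne (by omega) _ _
    set s₃ := Function.update s₂ p v₀ with hs₃
    have s₃_of : ∀ r, p < r → s₃ r = s₂ r := fun r hr => Function.update_of_ne hr.ne' _ _
    have hcopy : (copy (2 + slot) (p + 9)).exec s₁ = PMF.pure s₂ := by
      rw [exec_copy (by omega), s₁_of _ (by omega), h9]
    have haff₀ : (affine p (p + 10) (p + 6) (p + 5) (p + 3)).exec s₂ = PMF.pure s₃ := by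
      rw [exec_affine (by omega) (by omega), s₂_of _ (by omega), s₂_of _ (by omega),
        s₂_of _ (by omega), s₂_of _ (by omega), hs₁, Function.update_self, ← hs₁,
        s₁_of _ (by omega), s₁_of _ (by omega), s₁_of _ (by omega), h6, h5, h3]
    have haff₁ : (affine (p + 1) (p + 10) (p + 8) (p + 7) (p + 3)).exec s₃ =
        PMF.pure (Function.update s₃ (p + 1) v₁) := by
      rw [exec_affine (by omega) (by omega), s₃_of _ (by omega), s₃_of _ (by omega),
        s₃_of _ (by omega), s₃_of _ (by omega), s₂_of _ (by omega), s₂_of _ (by omega),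
        s₂_of _ (by omega), s₂_of _ (by omega), hs₁, Function.update_self, ← hs₁,
        s₁_of _ (by omega), s₁_of _ (by omega), s₁_of _ (by omega), h8, h7, h3]
    rw [exec_seq, exec_seq, hc, PMF.pure_bind, exec_seq, hcopy, PMF.pure_bind, exec_seq, haff₀,
      PMF.pure_bind, haff₁, PMF.pure_bind, exec_seq, exec_clear, PMF.pure_bind]
    congr 1
    funext r
    by_cases hr : r < p
    · rw [if_neg (by omega), Function.update_of_ne (by omega), hs₃, Function.update_of_ne (by omega)]
      match r with
      | 0 =>
        rw [hs₂, Function.update_of_ne (by omega), s₁_of _ (by omega)]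
        rfl
      | 1 =>
        rw [hs₂, Function.update_of_ne (by omega), s₁_of _ (by omega)]
        rfl
      | r + 2 =>
        rw [initStore, List.getD_cons_succ, List.getD_cons_succ,
          List.getD_append _ _ _ _ (by simp; omega)]
        by_cases hrs : r = slot
        · subst hrs
          rw [add_comm r 2, hs₂, Function.update_self, List.getD_eq_getElem _ _ (by simp; omega)]
          simp
        · rw [hs₂, Function.update_of_ne (by omega), s₁_of _ (by omega), add_comm r 2,
            hlow r (by omega), List.getD_eq_getElem _ _ (by omega),
            List.getD_eq_getElem _ _ (by simp; omega), List.getElem_set_ne (by omega)]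
    · obtain ⟨i, rfl⟩ : ∃ i, r = p + i := ⟨r - p, by omega⟩
      have hR : initStore (lam :: ℓ :: (xs.set slot κ ++ [v₀, v₁])) (p + i) =
          [v₀, v₁].getD i 0 := by
        rw [hp, show k + 2 + i = (k + i) + 1 + 1 by omega, initStore, List.getD_cons_succ,
          List.getD_cons_succ, List.getD_append_right _ _ _ _ (by simp; omega)]
        simp [hxs]
      rw [hR]
      match i with
      | 0 =>
        rw [if_neg (by omega), Function.update_of_ne (by omega), hs₃]
        exact Function.update_self _ _ _
      | 1 =>
        rw [if_neg (by omega)]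
        exact Function.update_self _ _ _
      | i + 2 =>
        rw [show [v₀, v₁].getD (i + 2) 0 = 0 from rfl]
        by_cases h : p + 2 ≤ p + (i + 2) ∧ p + (i + 2) ≤ p + 2 + 8
        · rw [if_pos h]
        · rw [if_neg h, Function.update_of_ne (by omega), s₃_of _ (by omega), s₂_of _ (by omega),
            s₁_of _ (by omega)]
          exact hinv.2.2 _ (by omega)

/-! ### Rules for computational indistinguishability -/

theorem PolyBounded.const (c : ℕ) : PolyBounded fun _ => c := ⟨Polynomial.C c, fun _ => by simp⟩

theorem PolyBounded.id : PolyBounded fun lam => lam := ⟨Polynomial.X, fun _ => by simp⟩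

theorem PolyBounded.add {g h : ℕ → ℕ} (hg : PolyBounded g) (hh : PolyBounded h) :
    PolyBounded fun lam => g lam + h lam := by
  obtain ⟨p, hp⟩ := hg
  obtain ⟨q, hq⟩ := hh
  exact ⟨p + q, fun lam => by rw [Polynomial.eval_add]; exact add_le_add (hp lam) (hq lam)⟩

theorem PolyBounded.mul {g h : ℕ → ℕ} (hg : PolyBounded g) (hh : PolyBounded h) :
    PolyBounded fun lam => g lam * h lam := by
  obtain ⟨p, hp⟩ := hg
  obtain ⟨q, hq⟩ := hh
  exact ⟨p * q, fun lam => by rw [Polynomial.eval_mul]; exact Nat.mul_le_mul (hp lam) (hq lam)⟩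

theorem PolyBounded.eval {g : ℕ → ℕ} (q : Polynomial ℕ) (hg : PolyBounded g) :
    PolyBounded fun lam => q.eval (g lam) := by
  obtain ⟨p, hp⟩ := hg
  exact ⟨q.comp p, fun lam => by
    rw [Polynomial.eval_comp]; exact polynomial_eval_mono q (hp lam)⟩

theorem Negligible.sum {ι : Type*} (s : Finset ι) {μ : ι → ℕ → ℝ} (h : ∀ j, Negligible (μ j)) :
    Negligible fun lam => ∑ j ∈ s, μ j lam := by
  have : Negligible (∑ j ∈ s, μ j) :=
    Finset.sum_induction _ Negligible (fun _ _ => Asymptotics.SuperpolynomialDecay.add)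
      (Asymptotics.superpolynomialDecay_zero _ _) fun j _ => h j
  refine Asymptotics.SuperpolynomialDecay.congr this fun lam => ?_
  simp

theorem CompIndist.comap {L : ℕ → ℕ} {m : ℕ} {ι κ : ℕ → Type} {X Y : ∀ lam, ι lam → PMF (List ℕ)}
    (h : CompIndist L m X Y) (g : ∀ lam, κ lam → ι lam) :
    CompIndist L m (fun lam i => X lam (g lam i)) (fun lam i => Y lam (g lam i)) := by
  intro a D z hD hz hzb
  obtain ⟨μ, hμ, h⟩ := h a D z hD hz hzb
  exact ⟨μ, hμ, fun lam i => h lam (g lam i)⟩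

theorem abs_accept_sub (D : Prog) (lam ℓ : ℕ) (z : List ℕ) (X Y : PMF (List ℕ)) :
    |accept D lam ℓ z X - accept D lam ℓ z Y| =
      gap (X.bind fun s => D.output 1 (lam :: ℓ :: (z ++ s)))
        (Y.bind fun s => D.output 1 (lam :: ℓ :: (z ++ s))) [1] := rfl

/-- Non-uniform security is uniform in the advice. -/
theorem CompIndist.uniform_advice {L : ℕ → ℕ} {m : ℕ} {ι : ℕ → Type}
    {X Y : ∀ lam, ι lam → PMF (List ℕ)} (h : CompIndist L m X Y) {a : ℕ} {D : Prog}
    (hD : PolyTime (a + m) D) {q : ℕ → ℕ} (hq : PolyBounded q) :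
    ∃ μ : ℕ → ℝ, Negligible μ ∧ ∀ lam (w : List ℕ) (i : ι lam), w.length = a →
      bitLength w ≤ q lam →
      |accept D lam (L lam) w (X lam i) - accept D lam (L lam) w (Y lam i)| ≤ μ lam := by
  let adv := fun lam (w : List ℕ) (i : ι lam) =>
    |accept D lam (L lam) w (X lam i) - accept D lam (L lam) w (Y lam i)|
  -- A single advice per security parameter attains, for some input, at least half of every positive
  -- advantage. The alternative `≤ 0` also covers an empty set of inputs.
  have hex : ∀ lam, ∃ z : List ℕ, (z.length = a ∧ bitLength z ≤ q lam) ∧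
      ∀ w i, w.length = a → bitLength w ≤ q lam →
        adv lam w i ≤ 0 ∨ ∃ i', adv lam w i ≤ 2 * adv lam z i' := by
    intro lam
    by_cases hpos : ∃ w i, (w.length = a ∧ bitLength w ≤ q lam) ∧ 0 < adv lam w i
    · obtain ⟨w₀, i₀, hw₀, hpos⟩ := hpos
      let T := {r | ∃ w i, (w.length = a ∧ bitLength w ≤ q lam) ∧ adv lam w i = r}
      have hT : BddAbove T := by
        refine ⟨1, ?_⟩
        rintro _ ⟨w, i, -, rfl⟩
        exact gap_le_one _ _ _
      have hle : ∀ w i, w.length = a → bitLength w ≤ q lam → adv lam w i ≤ sSup T :=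
        fun w i h₁ h₂ => le_csSup hT ⟨w, i, ⟨h₁, h₂⟩, rfl⟩
      have hsup : 0 < sSup T := hpos.trans_le (hle w₀ i₀ hw₀.1 hw₀.2)
      -- The supremum need not be attained, but half of it is exceeded because it is positive.
      obtain ⟨_, ⟨z, i', hz, rfl⟩, hlt⟩ :=
        exists_lt_of_lt_csSup (s := T) ⟨_, w₀, i₀, hw₀, rfl⟩ (half_lt_self hsup)
      refine ⟨z, hz, fun w i h₁ h₂ => Or.inr ⟨i', ?_⟩⟩
      have := hle w i h₁ h₂
      linarith
    · push Not at hpos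
      refine ⟨List.replicate a 0, ⟨by simp, ?_⟩, fun w i h₁ h₂ => Or.inl (hpos w i ⟨h₁, h₂⟩)⟩
      have : bitLength (List.replicate a 0) = 0 := by simp [bitLength]
      omega
  choose z hz hmax using hex
  obtain ⟨p, hp⟩ := hq
  obtain ⟨μ, hμ, hbound⟩ := h a D z hD (fun lam => (hz lam).1)
    ⟨p, fun lam => (hz lam).2.trans (hp lam)⟩
  refine ⟨fun lam => 2 * μ lam, Asymptotics.SuperpolynomialDecay.const_mul hμ 2,
    fun lam w i h₁ h₂ => ?_⟩
  rcases hmax lam w i h₁ h₂ with h | ⟨i', h⟩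
  · have h₀ : 0 ≤ adv lam (z lam) i := abs_nonneg _
    have := hbound lam i
    change adv lam w i ≤ _
    linarith
  · have := hbound lam i'
    change adv lam w i ≤ _
    linarith

/-- The last two components of indistinguishable tuples may be dropped. -/
theorem CompIndist.dropTwo {L : ℕ → ℕ} {m : ℕ} {ι : ℕ → Type} {X Y : ∀ lam, ι lam → PMF (List ℕ)}
    (h : CompIndist L (m + 2) X Y) (hX : ∀ lam i, ∀ s ∈ (X lam i).support, s.length = m + 2)
    (hY : ∀ lam i, ∀ s ∈ (Y lam i).support, s.length = m + 2) :
    CompIndist L m (fun lam i => (X lam i).map (List.take m))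
      (fun lam i => (Y lam i).map (List.take m)) := by
  intro a D z hD hz hzb
  -- The new distinguisher erases the two extra components and runs `D`; `clear _ 1` clears two
  -- registers.
  have hout : ∀ lam (s : List ℕ), s.length = m + 2 →
      (Prog.seq (clear (a + m + 2) 1) D).output 1 (lam :: L lam :: (z lam ++ s)) =
        D.output 1 (lam :: L lam :: (z lam ++ s.take m)) := by
    intro lam s hs
    have hlen : (lam :: L lam :: (z lam ++ s.take m)).length = a + m + 2 := by
      simp [hz, hs]
    rw [output_eq, output_eq, exec_seq, exec_clear, PMF.pure_bind]
    congr 2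
    funext r
    have happ : lam :: L lam :: (z lam ++ s) = lam :: L lam :: (z lam ++ s.take m) ++ s.drop m := by
      simp
    by_cases hr : r < a + m + 2
    · rw [if_neg (by omega), happ]
      exact List.getD_append _ _ _ _ (by omega)
    · have hz0 : initStore (lam :: L lam :: (z lam ++ s.take m)) r = 0 :=
        initStore_of_length_le (by omega)
      rw [hz0]
      split_ifs with hr'
      · rfl
      · exact initStore_of_length_le (by simp [hz, hs]; omega)
  have hacc : ∀ lam (Z : PMF (List ℕ)), (∀ s ∈ Z.support, s.length = m + 2) →
      accept D lam (L lam) (z lam) (Z.map (List.take m)) =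
        accept (.seq (clear (a + m + 2) 1) D) lam (L lam) (z lam) Z := by
    intro lam Z hZ
    rw [accept, accept, PMF.bind_map]
    congr 2
    exact bind_congr_support fun s hs => (hout lam s (hZ s hs)).symm
  have hpoly : PolyTime (a + (m + 2)) (.seq (clear (a + m + 2) 1) D) := by
    refine Fast.polyTime ((Fast.clear _ _ _).seq hD.fast fun lam ℓ s hs t ht => ?_)
    have hs := hs.inv (N := a + m + 4) (by omega)
    rw [exec_clear, PMF.mem_support_pure_iff] at ht
    have htr := congrFun ht
    refine Inv.initial ⟨?_, ?_, fun r hr => ?_⟩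
    · rw [htr, if_neg (by omega), hs.1]
    · rw [htr, if_neg (by omega), hs.2.1]
    · rw [htr]
      split_ifs with h
      · rfl
      · exact hs.2.2 r (by omega)
  obtain ⟨μ, hμ, h⟩ := h a _ z hpoly hz hzb
  refine ⟨μ, hμ, fun lam i => ?_⟩
  rw [hacc lam _ (hX lam i), hacc lam _ (hY lam i)]
  exact h lam i

theorem PolyTime.size_le {k : ℕ} {p : Prog} (h : PolyTime k p) :
    ∃ q : Polynomial ℕ, ∀ (lam ℓ : ℕ) (xs : List ℕ), xs.length = k →
      ∀ o ∈ (p.run (initStore (lam :: ℓ :: xs))).support, ∀ r,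
        (o.1 r).size ≤ q.eval (lam + ℓ + bitLength xs) := by
  obtain ⟨q, hq⟩ := h
  refine ⟨Polynomial.X + q, fun lam ℓ xs hxs o ho r => ?_⟩
  have h₁ := Prog.size_le _ _ _ ho r
  have h₂ := hq lam ℓ xs hxs o ho
  have h₃ : (initStore (lam :: ℓ :: xs) r).size ≤ lam + ℓ + bitLength xs := by
    rcases initStore_mem (xs := lam :: ℓ :: xs) r with h | h
    · simp [h]
    · have h₁ : lam.size ≤ lam := Nat.size_le.2 Nat.lt_two_pow_self
      have h₂ : ℓ.size ≤ ℓ := Nat.size_le.2 Nat.lt_two_pow_self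
      rcases List.mem_cons.1 h with h | h
      · rw [h]
        omega
      rcases List.mem_cons.1 h with h | h
      · rw [h]
        omega
      · have := size_le_bitLength h
        omega
  rw [Polynomial.eval_add, Polynomial.eval_X]
  omega

/-! ### The view as a function of independent components -/

/-- For one index: the corrupted party's share of `α`, the mask `α` and the corrupted party's key. -/
noncomputable def component {ℓ : ℕ} (keys : Ring2 ℓ → PMF ℕ) : PMF (Ring2 ℓ × Ring2 ℓ × ℕ) :=
  (PMF.uniformOfFintype (Ring2 ℓ)).bind fun a =>
    (PMF.uniformOfFintype (Ring2 ℓ)).bind fun α => (keys α).map fun κ => (a, α, κ)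

/-- What party `b` learns from the dealt material, together with the mask. -/
def Dealt.restrict {ℓ : ℕ} (b : Fin 2) (d : Dealt ℓ) : Ring2 ℓ × Ring2 ℓ × ℕ :=
  (d.alpha b, d.alpha 0 + d.alpha 1, d.key b)

def LUT.viewOf {ℓ n k : ℕ} (P : LUT ℓ n k) (b : Fin 2) (x : Fin 2 → Fin k → Ring2 ℓ)
    (o : Fin (n + 1) → Ring2 ℓ × Ring2 ℓ × ℕ) : View ℓ n k where
  input := x b
  alpha := fun i => (o i).1
  key := fun i => (o i).2.2
  received := P.masked (1 - b) (x (1 - b)) fun i => (o i).2.1 - (o i).1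

/-- For `b = 1` the share is the randomness `r` itself, and for `b = 0` the substitution `r ↦ α - r`
preserves the uniform distribution. -/
theorem deal_restrict (Φ : DCF) (lam ℓ : ℕ) (b : Fin 2) :
    (deal Φ lam ℓ).map (Dealt.restrict b) =
      component fun α => (Φ.genKeys lam α).map fun K => K b := by
  rw [component, PMF.bind_comm, deal, PMF.map_bind]
  congr 1
  funext α
  simp only [PMF.map_comp, PMF.map_bind, ← PMF.bind_pure_comp _ (Φ.genKeys lam α)]
  rw [PMF.bind_comm]
  congr 1
  funext K
  fin_cases b
  · rw [← PMF.bind_pure_comp]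
    refine Eq.trans ?_ (uniform_bind_eq_of_bijective (fun r => α - r)
      (Equiv.subLeft α).bijective _)
    congr 1
    funext r
    simp [Dealt.restrict, PMF.pure_map]
  · rw [← PMF.bind_pure_comp]
    congr 1
    funext r
    simp [Dealt.restrict, PMF.pure_map]

theorem LUT.realView_eq {ℓ n k : ℕ} (P : LUT ℓ n k) (x : Fin 2 → Fin k → Ring2 ℓ)
    (o : Fin (n + 1) → Dealt ℓ) (b : Fin 2) :
    P.realView x o b = P.viewOf b x fun i => (o i).restrict b := by
  have h : ∀ i, (o i).alpha (1 - b) = (o i).alpha 0 + (o i).alpha 1 - (o i).alpha b := by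
    intro i
    fin_cases b <;> simp
  simp only [LUT.realView, LUT.viewOf, Dealt.restrict, h]

theorem LUT.map_realView {ℓ n k : ℕ} (P : LUT ℓ n k) (Φ : DCF) (lam : ℕ)
    (x : Fin 2 → Fin k → Ring2 ℓ) (b : Fin 2) :
    (iid (deal Φ lam ℓ) (n + 1)).map (fun o => P.realView x o b) =
      (iid (component fun α => (Φ.genKeys lam α).map fun K => K b) (n + 1)).map (P.viewOf b x) := by
  rw [← deal_restrict, ← iid_map, PMF.map_comp]
  congr 1
  funext o
  exact P.realView_eq x o b

/-- The distribution of the simulated view. -/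
noncomputable def simView {ℓ k : ℕ} (n : ℕ) (keys : PMF ℕ) (xb : Fin k → Ring2 ℓ) :
    PMF (View ℓ n k) :=
  (iid (PMF.uniformOfFintype (Ring2 ℓ)) (n + 1)).bind fun a =>
    (iid keys (n + 1)).bind fun κ =>
      (PMF.uniformOfFintype (Fin n → Ring2 ℓ)).map fun ρ => ⟨xb, a, κ, ρ⟩

/-- With keys independent of the masks, each received message is a translate of a fresh uniform mask
by quantities fixed earlier. The view may then be written with the honest party's input, although
its distribution does not depend on it. -/
theorem simView_eq {ℓ n k : ℕ} (P : LUT ℓ n k) (keys : PMF ℕ) (x : Fin 2 → Fin k → Ring2 ℓ)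
    (b : Fin 2) :
    simView n keys (x b) = (iid (component fun _ => keys) (n + 1)).map (P.viewOf b x) := by
  have hcomp : (component fun _ : Ring2 ℓ => keys) =
      (PMF.uniformOfFintype (Ring2 ℓ)).bind fun a =>
        ((PMF.uniformOfFintype (Ring2 ℓ)).bind fun α => keys.map (Prod.mk α)).map (Prod.mk a) := by
    simp only [component, PMF.map_bind, PMF.map_comp]
    rfl
  rw [hcomp, iid_bind_map, iid_bind_map, simView, PMF.map_bind]
  congr 1
  funext a
  simp only [PMF.map_bind, PMF.map_comp]
  simp only [← PMF.bind_pure_comp _ (iid keys (n + 1))]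
  rw [PMF.bind_comm]
  congr 1
  funext κ
  simp only [Function.comp_def]
  have hshift : Function.Bijective fun (α : Fin n → Ring2 ℓ) (i : Fin n) =>
      ∑ j, P.coeff i j * x (1 - b) j + (α i - a i.succ) + ((1 - b : Fin 2).val : Ring2 ℓ) * P.offset i := by
    refine Function.bijective_iff_has_inverse.2 ⟨fun ρ i => ρ i -
      ((1 - b : Fin 2).val : Ring2 ℓ) * P.offset i - ∑ j, P.coeff i j * x (1 - b) j + a i.succ,
      fun α => ?_, fun ρ => ?_⟩ <;> funext i <;> ring
  rw [← uniform_map_of_bijective _ hshift, ← iid_uniform, ← iid_tail, PMF.map_comp, PMF.map_comp]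
  rfl

/-- Given shares and keys, the opened values are a translate of the uniform received messages. -/
theorem simView_opened {ℓ n k : ℕ} (P : LUT ℓ n k) (keys : PMF ℕ) (b : Fin 2)
    (xb : Fin k → Ring2 ℓ) :
    ((simView n keys xb).map fun v => ((v.alpha, v.key), P.opened b v)) =
      ((simView n keys xb).map fun v => (v.alpha, v.key)).bind fun c =>
        (PMF.uniformOfFintype (Fin n → Ring2 ℓ)).map fun r => (c, r) := by
  simp only [simView, PMF.map_bind, PMF.map_comp, PMF.bind_bind, PMF.bind_map, Function.comp_def,
    PMF.bind_const]
  congr 1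
  funext a
  congr 1
  funext κ
  have hshift : Function.Bijective fun (ρ : Fin n → Ring2 ℓ) (i : Fin n) => P.masked b xb a i + ρ i :=
    (Equiv.addLeft (fun i => P.masked b xb a i)).bijective
  conv_rhs => rw [← uniform_map_of_bijective _ hshift, PMF.map_comp]
  rfl

theorem map_val_uniform (ℓ : ℕ) :
    (PMF.uniformOfFintype (Ring2 ℓ)).map ZMod.val = uniformBits ℓ := by
  have hb : Function.Bijective fun z : Ring2 ℓ => (⟨z.val, ZMod.val_lt z⟩ : Fin (2 ^ ℓ)) := by
    rw [Fintype.bijective_iff_injective_and_card]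
    refine ⟨fun z z' h => ZMod.val_injective _ (by simpa using h), by simp [ZMod.card]⟩
  rw [uniformBits, ← uniform_map_of_bijective _ hb, PMF.map_comp]
  rfl

theorem map_toList_simView {ℓ n k : ℕ} (keys : PMF ℕ) (xb : Fin k → Ring2 ℓ) :
    (simView n keys xb).map View.toList =
      (iid (uniformBits ℓ) (n + 1)).bind fun a => (iid keys (n + 1)).bind fun κ =>
        (iid (uniformBits ℓ) n).map fun ρ =>
          (List.ofFn fun j => (xb j).val) ++ List.ofFn a ++ List.ofFn κ ++ List.ofFn ρ := by
  simp only [← map_val_uniform, ← iid_map, simView, PMF.map_bind, PMF.bind_map, PMF.map_comp,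
    iid_uniform]
  rfl

/-! ### Indistinguishability of the real and the simulated view -/

def View.setKey {ℓ n k : ℕ} (v : View ℓ n k) (j : Fin (n + 1)) (κ : ℕ) : View ℓ n k :=
  { v with key := Function.update v.key j κ }

theorem ofFn_update {t : ℕ} {β : Type*} (g : Fin t → β) (j : Fin t) (v : β) :
    List.ofFn (Function.update g j v) = (List.ofFn g).set j v := by
  refine List.ext_getElem (by simp) fun i h₁ h₂ => ?_
  simp [List.getElem_set, Function.update_apply, Fin.ext_iff, eq_comm]

theorem View.toList_setKey {ℓ n k : ℕ} (v : View ℓ n k) (j : Fin (n + 1)) (κ : ℕ) :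
    (v.setKey j κ).toList = v.toList.set (k + (n + 1) + j) κ := by
  simp only [View.toList, View.setKey, ofFn_update]
  rw [List.set_append_left _ _ (by simp; omega), List.set_append_right _ _ (by simp)]
  simp

theorem View.length_toList {ℓ n k : ℕ} (v : View ℓ n k) : v.toList.length = viewLength n k := by
  simp [View.toList, viewLength]
  omega

/-- A view together with a sharing of `y` that contains the output share determined by the view. -/
def LUT.withOutputs {ℓ n k : ℕ} (P : LUT ℓ n k) (Φ : DCF) (lam : ℕ) (b : Fin 2) (y : Ring2 ℓ)
    (v : View ℓ n k) : List ℕ :=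
  v.toList ++ (if b = 0 then [(P.outputShare Φ lam b v).val, (y - P.outputShare Φ lam b v).val]
    else [(y - P.outputShare Φ lam b v).val, (P.outputShare Φ lam b v).val])

theorem LUT.length_withOutputs {ℓ n k : ℕ} (P : LUT ℓ n k) (Φ : DCF) (lam : ℕ) (b : Fin 2)
    (y : Ring2 ℓ) (v : View ℓ n k) :
    (P.withOutputs Φ lam b y v).length = viewLength n k + 2 := by
  rw [withOutputs, List.length_append, v.length_toList]
  split_ifs <;> rfl

theorem LUT.take_withOutputs {ℓ n k : ℕ} (P : LUT ℓ n k) (Φ : DCF) (lam : ℕ) (b : Fin 2)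
    (y : Ring2 ℓ) (v : View ℓ n k) :
    (P.withOutputs Φ lam b y v).take (viewLength n k) = v.toList := by
  rw [withOutputs, List.take_left' v.length_toList]

/-- As a function of a single key, the output share is affine in the corresponding evaluation. -/
theorem LUT.outputShare_setKey {ℓ n k : ℕ} (P : LUT ℓ n k) (Φ : DCF) (lam : ℕ) (b : Fin 2)
    (v : View ℓ n k) (j : Fin (n + 1)) :
    ∃ m C A : Ring2 ℓ, ∀ κ,
      P.outputShare Φ lam b (v.setKey j κ) = Φ.evalShare lam b κ m * C + A := by
  refine Fin.cases ?_ (fun j => ?_) j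
  -- The key with index `0` is dealt but never evaluated.
  · refine ⟨0, 0, P.outputShare Φ lam b v, fun κ => ?_⟩
    rw [mul_zero, zero_add, outputShare, outputShare]
    congr 1
  · refine ⟨P.opened b v j, -(P.table j.succ - P.table j.castSucc),
      (b.val : Ring2 ℓ) * P.table 0 + ((b.val : Ring2 ℓ) * (P.table j.succ - P.table j.castSucc) +
        ∑ i ∈ Finset.univ.erase j,
          P.bitShare Φ lam b v i * (P.table i.succ - P.table i.castSucc)), fun κ => ?_⟩
    rw [outputShare, ← Finset.add_sum_erase _ _ (Finset.mem_univ j)]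
    have h₁ : P.bitShare Φ lam b (v.setKey j.succ κ) j =
        (b.val : Ring2 ℓ) - Φ.evalShare lam b κ (P.opened b v j) := by
      simp only [bitShare, View.setKey, Function.update_self]
      rfl
    have h₂ : ∀ i ∈ Finset.univ.erase j,
        P.bitShare Φ lam b (v.setKey j.succ κ) i * (P.table i.succ - P.table i.castSucc) =
          P.bitShare Φ lam b v i * (P.table i.succ - P.table i.castSucc) := by
      intro i hi
      have hij : i.succ ≠ j.succ := fun h => Finset.ne_of_mem_erase hi (Fin.succ_injective _ h)
      simp only [bitShare, View.setKey, Function.update_of_ne hij]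
      rfl
    rw [h₁, Finset.sum_congr rfl h₂]
    ring

theorem val_affine {ℓ : ℕ} (e : ℕ) (C A : Ring2 ℓ) :
    ((e : Ring2 ℓ) * C + A).val = (e * C.val + A.val) % 2 ^ ℓ := by
  rw [← ZMod.val_natCast]
  push_cast
  rw [ZMod.natCast_zmod_val, ZMod.natCast_zmod_val]

/-- Both output shares are affine in the same evaluation, with opposite slopes, since they add up to
`y`. Natural representatives put this into the form the reduction computes. -/
theorem LUT.withOutputs_setKey {ℓ n k : ℕ} (P : LUT ℓ n k) (Φ : DCF) (lam : ℕ) (b : Fin 2)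
    (y : Ring2 ℓ) (v : View ℓ n k) (j : Fin (n + 1)) :
    ∃ m A₀ C₀ A₁ C₁ : Ring2 ℓ, ∀ κ,
      P.withOutputs Φ lam b y (v.setKey j κ) = v.toList.set (k + (n + 1) + j) κ ++
        [(Φ.share lam ℓ b κ m.val * C₀.val + A₀.val) % 2 ^ ℓ,
          (Φ.share lam ℓ b κ m.val * C₁.val + A₁.val) % 2 ^ ℓ] := by
  obtain ⟨m, C, A, h⟩ := P.outputShare_setKey Φ lam b v j
  have h' : ∀ κ, y - P.outputShare Φ lam b (v.setKey j κ) =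
      Φ.evalShare lam b κ m * (-C) + (y - A) := by
    intro κ
    rw [h]
    ring
  by_cases hb : b = 0
  · refine ⟨m, A, C, y - A, -C, fun κ => ?_⟩
    rw [withOutputs, if_pos hb, View.toList_setKey, h', h, DCF.evalShare, val_affine, val_affine]
  · refine ⟨m, y - A, -C, A, C, fun κ => ?_⟩
    rw [withOutputs, if_neg hb, View.toList_setKey, h', h, DCF.evalShare, val_affine, val_affine]

theorem size_val_le {ℓ : ℕ} (z : Ring2 ℓ) : z.val.size ≤ ℓ := Nat.size_le.2 (ZMod.val_lt z)

theorem View.size_le {ℓ n k : ℕ} (v : View ℓ n k) {B : ℕ} (hB : ∀ i, (v.key i).size ≤ B) :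
    ∀ x ∈ v.toList, x.size ≤ ℓ + B := by
  intro x hx
  simp only [View.toList, List.mem_append, List.mem_ofFn'] at hx
  rcases hx with ((⟨i, rfl⟩ | ⟨i, rfl⟩) | ⟨i, rfl⟩) | ⟨i, rfl⟩
  · exact (size_val_le (v.input i)).trans (by omega)
  · exact (size_val_le (v.alpha i)).trans (by omega)
  · exact (hB i).trans (by omega)
  · exact (size_val_le (v.received i)).trans (by omega)

/-- The key of an index enters the view in one place only, so it can be separated from the data that
go into the advice. -/
theorem LUT.viewOf_update {ℓ n k : ℕ} (P : LUT ℓ n k) (b : Fin 2) (x : Fin 2 → Fin k → Ring2 ℓ)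
    (o : Fin (n + 1) → Ring2 ℓ × Ring2 ℓ × ℕ) (j : Fin (n + 1)) (a α : Ring2 ℓ) (κ : ℕ) :
    P.viewOf b x (Function.update o j (a, α, κ)) =
      (P.viewOf b x (Function.update o j (a, α, 0))).setKey j κ := by
  have h : ∀ {β : Type} (g : Ring2 ℓ × Ring2 ℓ × ℕ → β), g (a, α, κ) = g (a, α, 0) → ∀ i,
      g (Function.update o j (a, α, κ) i) = g (Function.update o j (a, α, 0) i) := by
    intro β g hg i
    rw [Function.update_apply, Function.update_apply]
    split_ifs
    · exact hg
    · rfl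
  simp only [viewOf, View.setKey, View.mk.injEq, true_and]
  refine ⟨funext (h (fun c => c.1) rfl), ?_, ?_⟩
  · funext i
    rw [Function.update_apply, Function.update_apply, Function.update_apply]
    split_ifs <;> rfl
  · congr 1
    exact funext (h (fun c => c.2.1 - c.1) rfl)

theorem compIndist_withOutputs {Φ : DCF} {L : ℕ → ℕ} (hL : PolyBounded L) {n k : ℕ}
    (P : ∀ lam, LUT (L lam) n k) (b : Fin 2) {Sim : Prog} (hSim : PolyTime 0 Sim)
    (hind : CompIndist L 1 (ι := fun lam => Ring2 (L lam))
      (fun lam α => (Φ.genKeys lam α).map fun K => [K b])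
      (fun lam _ => Sim.output 1 [lam, L lam])) :
    CompIndist L (viewLength n k + 2)
      (ι := fun lam => (Fin 2 → Fin k → Ring2 (L lam)) × Ring2 (L lam))
      (fun lam i => ((iid (component fun α => (Φ.genKeys lam α).map fun K => K b) (n + 1)).map
        ((P lam).viewOf b i.1)).map ((P lam).withOutputs Φ lam b i.2))
      (fun lam i => ((iid (component fun _ => Sim.result [lam, L lam]) (n + 1)).map
        ((P lam).viewOf b i.1)).map ((P lam).withOutputs Φ lam b i.2)) := by
  intro a D z hD hz hzb
  obtain ⟨qg, hqg⟩ := Φ.gen_polyTime.size_le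
  obtain ⟨qs, hqs⟩ := hSim.size_le
  let B : ℕ → ℕ := fun lam => qg.eval (lam + L lam + L lam) + qs.eval (lam + L lam)
  have hB : PolyBounded B :=
    (PolyBounded.eval qg ((PolyBounded.id.add hL).add hL)).add
      (PolyBounded.eval qs (PolyBounded.id.add hL))
  -- Bounds every advice entry; the final `1` is for the modulus `2 ^ ℓ`, which has `ℓ + 1` bits,
  -- and for the party's index.
  let Mb : ℕ → ℕ := fun lam => bitLength (z lam) + (L lam + B lam) + 1
  have hMb : PolyBounded Mb := (hzb.add (hL.add hB)).add (PolyBounded.const 1)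
  have hgen : ∀ lam (α : Ring2 (L lam)), ∀ κ ∈ ((Φ.genKeys lam α).map fun K => K b).support,
      κ.size ≤ B lam := by
    intro lam α κ hκ
    rw [DCF.genKeys, PMF.map_comp, PMF.mem_support_map_iff] at hκ
    obtain ⟨o, ho, rfl⟩ := hκ
    refine (hqg lam (L lam) [α.val] rfl o ho b.val).trans ?_
    have : bitLength [α.val] ≤ L lam := by simpa [bitLength] using size_val_le α
    exact (polynomial_eval_mono qg (by omega)).trans (Nat.le_add_right _ _)
  have hsim : ∀ lam, ∀ κ ∈ (Sim.result [lam, L lam]).support, κ.size ≤ B lam := by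
    intro lam κ hκ
    rw [Prog.result, PMF.mem_support_map_iff] at hκ
    obtain ⟨s, hs, rfl⟩ := hκ
    obtain ⟨c, hc⟩ := mem_support_exec.1 hs
    exact (hqs lam (L lam) [] rfl _ hc 0).trans (by simp [bitLength, B])
  have hred := fun j : Fin (n + 1) => exists_reduction Φ (k := a + viewLength n k) hD
    (slot := a + (k + (n + 1) + j)) (by simp only [viewLength]; omega)
  choose R hR hRout using hred
  have hunif := fun j => hind.uniform_advice (hR j)
    (((PolyBounded.const (a + viewLength n k + 9)).mul hMb))
  choose μ hμ hbound using hunif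
  refine ⟨_, Negligible.sum Finset.univ hμ, fun lam i => ?_⟩
  obtain ⟨x, y⟩ := i
  beta_reduce
  rw [abs_accept_sub, PMF.map_comp, PMF.map_comp, PMF.bind_map, PMF.bind_map]
  -- `Good` records that keys are short, whether real or simulated, so each hybrid's advice stays
  -- polynomial.
  refine gap_iid_le _ _ {c | c.2.2.size ≤ B lam} ?_ ?_ _ _ _ _ fun j o ho => ?_
  · intro c hc
    simp only [component, PMF.mem_support_bind_iff, PMF.mem_support_map_iff] at hc
    obtain ⟨a, -, α, -, κ, hκ, rfl⟩ := hc
    exact hgen lam α κ (by simpa using hκ)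
  · intro c hc
    simp only [component, PMF.mem_support_bind_iff, PMF.mem_support_map_iff] at hc
    obtain ⟨a, -, α, -, κ, hκ, rfl⟩ := hc
    exact hsim lam κ hκ
  · simp only [component, PMF.bind_bind]
    -- With share and mask of index `j` fixed, only the key is random, and `α` is the input of the
    -- DCF ensemble.
    refine gap_bind_le _ _ _ _ _ fun a' _ => gap_bind_le _ _ _ _ _ fun α _ => ?_
    set v := (P lam).viewOf b x (Function.update o j (a', α, 0)) with hv
    obtain ⟨m, A₀, C₀, A₁, C₁, hout⟩ := (P lam).withOutputs_setKey Φ lam b y v j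
    have hkey : ∀ i, (v.key i).size ≤ B lam := by
      intro i
      simp only [hv, LUT.viewOf, Function.update_apply]
      split_ifs
      · simp
      · exact ho i
    let w := (z lam ++ v.toList) ++
      [0, 0, b.val, 2 ^ L lam, m.val, A₀.val, C₀.val, A₁.val, C₁.val]
    have hwlen : w.length = a + viewLength n k + 9 := by
      simp [w, hz, View.length_toList]
      omega
    have hwsize : bitLength w ≤ (a + viewLength n k + 9) * Mb lam := by
      rw [← hwlen]
      refine bitLength_le fun c hc => ?_
      simp only [w, List.mem_append, List.mem_cons, List.not_mem_nil, or_false] at hc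
      rcases hc with (hc | hc) | hc | hc | hc | hc | hc | hc | hc | hc | hc
      · have := size_le_bitLength hc
        simp only [Mb]
        omega
      · have := v.size_le hkey c hc
        simp only [Mb]
        omega
      · simp [hc]
      · simp [hc]
      · have : b.val.size ≤ 1 := Nat.size_le.2 b.isLt
        simp only [hc, Mb]
        omega
      · rw [hc, Nat.size_pow]
        simp only [Mb]
        omega
      all_goals
        rw [hc]
        refine (size_val_le _).trans ?_
        simp only [Mb]
        omega
    have hmain : ∀ κ, D.output 1 (lam :: L lam :: (z lam ++
        (P lam).withOutputs Φ lam b y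
          ((P lam).viewOf b x (Function.update o j (a', α, κ))))) =
        (R j).output 1 (lam :: L lam :: (w ++ [κ])) := by
      intro κ
      rw [LUT.viewOf_update, ← hv, hout κ,
        hRout j lam (L lam) (z lam ++ v.toList) b (2 ^ L lam) m.val A₀.val C₀.val A₁.val C₁.val κ
          (by simp [hz, View.length_toList])]
      rw [List.set_append_right _ _ (by rw [hz]; omega), hz, Nat.add_sub_cancel_left,
        List.append_assoc]
    have := hbound j lam w α hwlen hwsize
    rw [abs_accept_sub, PMF.bind_map] at this
    simp only [output_one Sim, PMF.bind_map, PMF.map_comp, Function.comp_def, hmain] at this ⊢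
    exact this

/-! ### Correctness of the protocols -/

theorem signed_intCast {ℓ : ℕ} {d : ℤ} (h : InRange ℓ d) : signed (d : Ring2 ℓ) = d := by
  obtain ⟨h₁, h₂⟩ := h
  have hval : ((d : Ring2 ℓ).val : ℤ) = d % 2 ^ ℓ := by
    rw [ZMod.val_intCast]
    push_cast
    rfl
  have hpos : (0 : ℤ) < 2 ^ ℓ := by positivity
  have hcond : 2 * (d : Ring2 ℓ).val < 2 ^ ℓ ↔ 2 * (d % 2 ^ ℓ) < 2 ^ ℓ := by
    rw [← hval]
    norm_cast
  rw [signed, hval]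
  rcases le_or_gt 0 d with hd | hd
  · have hmod : d % 2 ^ ℓ = d := Int.emod_eq_of_lt hd (by omega)
    rw [if_pos (by rw [hcond, hmod]; exact h₂), hmod]
  · have hmod : d % 2 ^ ℓ = d + 2 ^ ℓ := by
      rw [← Int.add_emod_right, Int.emod_eq_of_lt (by omega) (by omega)]
    rw [if_neg (by rw [hcond, hmod]; omega), hmod]
    ring

theorem intCast_signed {ℓ : ℕ} (z : Ring2 ℓ) : ((signed z : ℤ) : Ring2 ℓ) = z := by
  have hpow : (2 : Ring2 ℓ) ^ ℓ = 0 := by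
    have := ZMod.natCast_self (2 ^ ℓ)
    push_cast at this
    exact this
  rw [signed]
  split_ifs
  · rw [Int.cast_natCast, ZMod.natCast_zmod_val]
  · push_cast
    rw [ZMod.natCast_zmod_val, hpow, sub_zero]

theorem sum_segments {R : Type*} [AddCommGroup R] (t : ℕ → R) (n I : ℕ) :
    t 0 + ∑ i : Fin n, (if (i : ℕ) + 1 ≤ I then t (i + 1) - t i else 0) = t (min I n) := by
  rw [Fin.sum_univ_eq_sum_range fun i => if i + 1 ≤ I then t (i + 1) - t i else 0]
  induction n with
  | zero => simp
  | succ n ih =>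
    rw [Finset.sum_range_succ, ← add_assoc, ih]
    split_ifs with h
    · rw [min_eq_right (by omega), min_eq_right h]
      abel
    · rw [min_eq_left (by omega), min_eq_left (by omega), add_zero]

/-- The difference between the input and the `i`-th knot. -/
def LUT.diff {ℓ n k : ℕ} (P : LUT ℓ n k) (x : Fin k → Ring2 ℓ) (i : Fin n) : Ring2 ℓ :=
  ∑ j, P.coeff i j * x j + P.offset i

theorem LUT.opened_realView {ℓ n k : ℕ} (P : LUT ℓ n k) (x : Fin 2 → Fin k → Ring2 ℓ)
    (o : Fin (n + 1) → Dealt ℓ) (b : Fin 2) (i : Fin n) :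
    P.opened b (P.realView x o b) i =
      P.diff (x 0 + x 1) i + ((o i.succ).alpha 0 + (o i.succ).alpha 1) := by
  have hsum : ∑ j, P.coeff i j * (x 0 + x 1) j =
      ∑ j, P.coeff i j * x 0 j + ∑ j, P.coeff i j * x 1 j := by
    simp only [Pi.add_apply, mul_add, Finset.sum_add_distrib]
  rw [diff, hsum]
  fin_cases b <;> simp [opened, masked, realView] <;> ring

/-- `hdiff` says that the comparison bits form an initial segment of ones, which is what makes the
table differences telescope. -/
theorem LUT.outputShare_add {Φ : DCF} {L : ℕ → ℕ} (hcorrect : Φ.Correct L) {lam n k : ℕ}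
    (P : LUT (L lam) n k) (x : Fin 2 → Fin k → Ring2 (L lam)) {o : Fin (n + 1) → Dealt (L lam)}
    (ho : ∀ i, o i ∈ (deal Φ lam (L lam)).support) (t : ℕ → Ring2 (L lam))
    (ht : ∀ i, P.table i = t i) (I : ℕ) (hI : I ≤ n)
    (hdiff : ∀ i : Fin n, 0 ≤ signed (P.diff (x 0 + x 1) i) ↔ (i : ℕ) + 1 ≤ I) :
    P.outputShare Φ lam 0 (P.realView x o 0) + P.outputShare Φ lam 1 (P.realView x o 1) = t I := by
  have hbit : ∀ i : Fin n, P.bitShare Φ lam 0 (P.realView x o 0) i +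
      P.bitShare Φ lam 1 (P.realView x o 1) i = if (i : ℕ) + 1 ≤ I then 1 else 0 := by
    intro i
    have hmem := ho i.succ
    simp only [deal, PMF.mem_support_bind_iff, PMF.mem_support_map_iff] at hmem
    obtain ⟨α, -, K, hK, r, -, hd⟩ := hmem
    have hα : (o i.succ).alpha 0 + (o i.succ).alpha 1 = α := by simp [← hd]
    have hkey : (o i.succ).key = K := by rw [← hd]
    have hshare := hcorrect lam α K hK (P.diff (x 0 + x 1) i + α)
    rw [less, add_sub_cancel_right] at hshare
    simp only [bitShare, opened_realView, hα]
    simp only [realView, hkey]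
    rw [sub_add_sub_comm, hshare]
    by_cases h : (i : ℕ) + 1 ≤ I
    · rw [if_pos h, if_neg (not_lt.2 ((hdiff i).2 h))]
      simp
    · rw [if_neg h, if_pos (not_le.1 fun h' => h ((hdiff i).1 h'))]
      simp
  have hsum : ∑ i : Fin n, P.bitShare Φ lam 0 (P.realView x o 0) i *
        (P.table i.succ - P.table i.castSucc) +
      ∑ i : Fin n, P.bitShare Φ lam 1 (P.realView x o 1) i *
        (P.table i.succ - P.table i.castSucc) =
      ∑ i : Fin n, if (i : ℕ) + 1 ≤ I then t (i + 1) - t i else 0 := by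
    rw [← Finset.sum_add_distrib]
    refine Finset.sum_congr rfl fun i _ => ?_
    rw [← add_mul, hbit, ht, ht, ite_mul, one_mul, zero_mul]
    rfl
  have h := sum_segments t n I
  rw [min_eq_left hI, ← hsum] at h
  rw [← h, outputShare, outputShare, ht]
  simp
  ring

/-- A deterministic sum turns the honest output into a function of the corrupted view, so joint
indistinguishability reduces to that of views. -/
theorem LUT.real_eq {Φ : DCF} {lam ℓ n k : ℕ} (P : LUT ℓ n k) (b : Fin 2)
    (x : Fin 2 → Fin k → Ring2 ℓ) (y : Ring2 ℓ)
    (h : ∀ o : Fin (n + 1) → Dealt ℓ, (∀ i, o i ∈ (deal Φ lam ℓ).support) →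
      P.outputShare Φ lam 0 (P.realView x o 0) + P.outputShare Φ lam 1 (P.realView x o 1) = y) :
    P.real Φ lam b x =
      ((iid (deal Φ lam ℓ) (n + 1)).map fun o => P.realView x o b).map
        (P.withOutputs Φ lam b y) := by
  rw [real, PMF.map_comp]
  refine map_congr_support fun o ho => ?_
  have hy := h o (mem_support_iid ho)
  rw [Function.comp_apply, withOutputs]
  congr 1
  by_cases hb : b = 0
  · subst hb
    rw [if_pos rfl, ← hy, add_sub_cancel_left]
  · obtain rfl : b = 1 := by omega
    rw [if_neg hb, ← hy, add_sub_cancel_right]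

/-! ### Knots, segments and the signs of the differences. -/

theorem knotFixed_mono (f n : ℕ) : Monotone (knotFixed f n) := by
  intro i j hij
  have hk : knot n i ≤ knot n j := by
    unfold knot
    gcongr
  unfold knotFixed fixedPoint
  have := Int.floor_le_floor (mul_le_mul_of_nonneg_right hk (show (0 : ℝ) ≤ 2 ^ f by positivity))
  gcongr

theorem segmentIndex_le (f n : ℕ) (t : ℝ) : segmentIndex f n t ≤ n := Nat.findGreatest_le n

/-- By monotonicity, the knots not exceeding `t` are an initial segment. The index `0` is excluded
because it is also the default value to the left of all knots. -/
theorem le_segmentIndex_iff {f n i : ℕ} {t : ℝ} (h₁ : 1 ≤ i) (h₂ : i ≤ n) :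
    i ≤ segmentIndex f n t ↔ knotFixed f n i ≤ t := by
  classical
  unfold segmentIndex
  refine ⟨fun h => ?_, fun h => Nat.le_findGreatest h₂ h⟩
  exact (knotFixed_mono f n h).trans (Nat.findGreatest_of_ne_zero
    (P := fun i => knotFixed f n i ≤ t) rfl (by omega))

theorem sigmoid_diff {ℓ f n : ℕ} {x : Fin 1 → Ring2 ℓ} (hx : sigmoidAdm ℓ f n x) (i : Fin n) :
    0 ≤ signed ((sigmoidLUT ℓ f n).diff x i) ↔
      (i : ℕ) + 1 ≤ segmentIndex f n (decode f (x 0)) := by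
  have hd : (sigmoidLUT ℓ f n).diff x i =
      ((signed (x 0) - fixedPoint f (knot n ((i : ℕ) + 1 : ℕ)) : ℤ) : Ring2 ℓ) := by
    simp [LUT.diff, sigmoidLUT, intCast_signed, sub_eq_add_neg]
  rw [hd, signed_intCast (hx _ (Finset.mem_Icc.2 ⟨by omega, i.isLt⟩)),
    le_segmentIndex_iff (by omega) i.isLt, knotFixed, decode,
    div_le_div_iff_of_pos_right (by positivity), Int.cast_le, sub_nonneg]

/-- The scale `2 ^ f` cancels in `-G / H`, and `H > 0` allows the knot inequality to be multiplied
out into the sign of an integer that does not overflow. -/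
theorem leaf_diff {ℓ f n : ℕ} {x : Fin 2 → Ring2 ℓ} (hx : leafAdm ℓ f n x) (i : Fin n) :
    0 ≤ signed ((leafLUT ℓ f n).diff x i) ↔
      (i : ℕ) + 1 ≤ segmentIndex f n (-decode f (x 0) / decode f (x 1)) := by
  have hd : (leafLUT ℓ f n).diff x i =
      ((-(2 ^ f * signed (x 0)) - fixedPoint f (knot n ((i : ℕ) + 1 : ℕ)) * signed (x 1) : ℤ) :
        Ring2 ℓ) := by
    simp [LUT.diff, leafLUT, intCast_signed, sub_eq_add_neg]
  obtain ⟨hH, hx⟩ := hx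
  have hH' : (0 : ℝ) < signed (x 1) := by exact_mod_cast hH
  have hpow : (0 : ℝ) < 2 ^ f := by positivity
  rw [hd, signed_intCast (hx _ (Finset.mem_Icc.2 ⟨by omega, i.isLt⟩)),
    le_segmentIndex_iff (by omega) i.isLt, knotFixed, decode, decode, ← neg_div,
    div_div_div_cancel_right₀ hpow.ne', div_le_div_iff₀ hpow hH', ← @Int.cast_nonneg_iff ℝ]
  push_cast
  constructor <;> intro h <;> linarith

/-! ### Security of the protocols -/

theorem securelyComputes_of_outputShare_add {Φ : DCF} {L : ℕ → ℕ} {n k : ℕ} (hL : PolyBounded L)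
    (hsecure : Φ.Secure L) (P : ∀ lam, LUT (L lam) n k)
    (F : ∀ lam, (Fin k → Ring2 (L lam)) → Ring2 (L lam))
    (Adm : ∀ lam, (Fin k → Ring2 (L lam)) → Prop)
    (hadd : ∀ lam (x : Fin 2 → Fin k → Ring2 (L lam)), Adm lam (x 0 + x 1) →
      ∀ o : Fin (n + 1) → Dealt (L lam), (∀ i, o i ∈ (deal Φ lam (L lam)).support) →
        (P lam).outputShare Φ lam 0 ((P lam).realView x o 0) +
          (P lam).outputShare Φ lam 1 ((P lam).realView x o 1) = F lam (x 0 + x 1)) :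
    SecurelyComputes Φ L P F Adm := by
  intro b
  obtain ⟨Sim, hSim, hind⟩ := hsecure b
  obtain ⟨S, hS, hSout⟩ := exists_simulator hSim n k
  have hcore := compIndist_withOutputs hL P b hSim hind
  refine ⟨S, fun lam xb => simView n (Sim.result [lam, L lam]) xb, hS, fun lam xb => ?_,
    fun lam xb => simView_opened (P lam) _ b xb, ?_, ?_⟩
  · rw [map_toList_simView]
    exact hSout lam (L lam) _ (by simp)
  · convert hcore.comap fun lam (x : {x : Fin 2 → Fin k → Ring2 (L lam) //
      Adm lam (x 0 + x 1)}) => (x.1, F lam (x.1 0 + x.1 1)) using 3 with lam x lam x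
    · rw [(P lam).real_eq b x.1 _ (hadd lam x.1 x.2), LUT.map_realView]
    · rw [← simView_eq]
      rfl
  -- The core statement holds for every `y`, so `y = 0` serves here and admissibility is not needed
  -- once the outputs are dropped.
  · have hlen : ∀ lam (i : (Fin 2 → Fin k → Ring2 (L lam)) × Ring2 (L lam))
        (Z : PMF (View (L lam) n k)), ∀ s ∈ (Z.map ((P lam).withOutputs Φ lam b i.2)).support,
        s.length = viewLength n k + 2 := by
      intro lam i Z s hs
      rw [PMF.mem_support_map_iff] at hs
      obtain ⟨v, -, rfl⟩ := hs
      exact LUT.length_withOutputs _ _ _ _ _ _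
    convert (hcore.dropTwo (fun lam i => hlen lam i _) fun lam i => hlen lam i _).comap
      fun lam (x : Fin 2 → Fin k → Ring2 (L lam)) => (x, 0) using 3 with lam x lam x
    · rw [PMF.map_comp, ← LUT.map_realView, PMF.map_comp, LUT.realViewOnly]
      congr 1
      funext o
      exact ((P lam).take_withOutputs Φ lam b 0 _).symm
    · rw [PMF.map_comp, ← simView_eq]
      congr 1
      funext v
      exact ((P lam).take_withOutputs Φ lam b 0 v).symm

end GuardGBDT

theorem mainTheorem1 (Φ : GuardGBDT.DCF) (L f : ℕ → ℕ) (n : ℕ) (hn : 0 < n)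
    (hL : GuardGBDT.PolyBounded L) (hcorrect : Φ.Correct L) (hsecure : Φ.Secure L) :
    GuardGBDT.SecurelyComputes Φ L
        (fun lam => GuardGBDT.sigmoidLUT (L lam) (f lam) n)
        (fun lam => GuardGBDT.sigmoidIdeal (L lam) (f lam) n)
        (fun lam => GuardGBDT.sigmoidAdm (L lam) (f lam) n) ∧
      GuardGBDT.SecurelyComputes Φ L
        (fun lam => GuardGBDT.leafLUT (L lam) (f lam) n)
        (fun lam => GuardGBDT.leafIdeal (L lam) (f lam) n)
        (fun lam => GuardGBDT.leafAdm (L lam) (f lam) n) := by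
  constructor
  · refine GuardGBDT.securelyComputes_of_outputShare_add hL hsecure _ _ _ fun lam x hx o ho => ?_
    exact GuardGBDT.LUT.outputShare_add hcorrect _ x ho
      (fun i => (GuardGBDT.fixedPoint (f lam) (Real.sigmoid (GuardGBDT.knot n i)) :
        GuardGBDT.Ring2 (L lam)))
      (fun _ => rfl) _ (GuardGBDT.segmentIndex_le _ _ _) (GuardGBDT.sigmoid_diff hx)
  · refine GuardGBDT.securelyComputes_of_outputShare_add hL hsecure _ _ _ fun lam x hx o ho => ?_
    exact GuardGBDT.LUT.outputShare_add hcorrect _ x ho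
      (fun i => (GuardGBDT.fixedPoint (f lam) (GuardGBDT.knot n i) : GuardGBDT.Ring2 (L lam)))
      (fun _ => rfl) _ (GuardGBDT.segmentIndex_le _ _ _) (GuardGBDT.leaf_diff hx)
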